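/- **Model.** The vertex set is $[n]$. A dynamic stream for a simple graph $G=([n],E)$ is a finite sequence $\sigma=\langle (\{u_i,v_i\},\Delta_i)\rangle_i$ with $u_i\neq v_i$ and $\Delta_i\in\{1,-1\}$ (insertion/deletion of the edge $\{u_i,v_i\}$) such that the sum of the $\Delta_i$ over all items with $\{u_i,v_i\}=e$ is $1$ if $e\in E$ and $0$ if $e\notin E$. Write $m=|E|$ and let $\mathrm{OPT}(G)$ be the MAX-CUT value of $G$, i.e. the maximum over all bipartitions of $[n]$ of the number of edges between the two sides. For an optimal cut $x^*\in\{-1,1\}^n$, an $\epsilon$-accurate oracle is a random vector $Y\in\{-1,1\}^n$ with independent entries and $\Pr[Y_v=x^*_v]=\frac12+\epsilon$, $\Pr[Y_v=-x^*_v]=\frac12-\epsilon$ for every $v$; each stream item is given to the algorithm together with the predictions $(Y_{u_i},Y_{v_i})$ of its endpoints. A randomized single-pass streaming algorithm using $s$ bits of space keeps a memory of $s$ bits (including any random bits that it reuses), which is initialized at random, is updated, possibly with fresh random coins, at each stream item, and determines the real number returned at the end. **Theorem.** For every $\kappa\ge 1$ there are constants $c,C,K>0$, depending only on $\kappa$,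 such that the following holds. For every $n$, every $\epsilon'\in(0,\frac12]$ and every $\delta\in(0,1)$ there is a randomized single-pass streaming algorithm using at most $$C\cdot\frac{\log^2 n}{\epsilon'^{7}\delta^{3}}\log\frac{1}{\epsilon'\delta}$$ bits of space with the following guarantee. Let $\epsilon\in(0,\frac12]$ satisfy $\epsilon'/\kappa\le\epsilon\le\kappa\epsilon'$ (so the algorithm knows $\epsilon$ only up to the factor $\kappa$; $\epsilon'=\epsilon$ is allowed). Then for every graph $G$ on $[n]$ with $m\ge K\epsilon^{-11}\delta^{-7}$, every dynamic stream $\sigma$ for $G$, every optimal cut $x^*$ of $G$, and every $\epsilon$-accurate oracle $Y$ for $x^*$, the output $\mathrm{ALG}$ of the algorithm on $\sigma$ satisfies $$\Bigl(\tfrac12+c\,\epsilon^2\Bigr)\,\mathrm{OPT}(G)\;\le\;\mathrm{ALG}\;\le\;\mathrm{OPT}(G)$$ with probability at least $1-\delta$ over $Y$ and the algorithm's independent internal randomness. -/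

import Mathlib

open MeasureTheory ProbabilityTheory

/-- One item of a dynamic edge stream on the vertex set `Fin n`: the edge `{u, v}` (given in either
orientation) is inserted if `ins = true` and deleted if `ins = false`. -/
structure EdgeUpdate (n : ℕ) where
  u : Fin n
  v : Fin n
  ins : Bool

/-- The sign `Δ = 1` (insertion) or `Δ = -1` (deletion) of an update. -/
def EdgeUpdate.sign {n : ℕ} (a : EdgeUpdate n) : ℤ := if a.ins then 1 else -1

/-- Net multiplicity of the unordered pair `e` in the stream: insertions minus deletions. -/
def netMultiplicity {n : ℕ} (σ : List (EdgeUpdate n)) (e : Sym2 (Fin n)) : ℤ :=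
  (σ.map fun a => if s(a.u, a.v) = e then a.sign else 0).sum

/-- `σ` is a dynamic (insertion/deletion) stream whose final graph is `G`: no item is a loop, and
at the end every edge of `G` has net multiplicity one and every other pair has net multiplicity
zero. Every sequence that inserts only absent edges, deletes only present ones and ends in `G` is
such a stream. -/
def IsDynamicStream {n : ℕ} (σ : List (EdgeUpdate n)) (G : SimpleGraph (Fin n)) : Prop :=
  (∀ a ∈ σ, a.u ≠ a.v) ∧
    ∀ e : Sym2 (Fin n),
      (e ∈ G.edgeSet → netMultiplicity σ e = 1) ∧ (e ∉ G.edgeSet → netMultiplicity σ e = 0)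

/-- An update together with the predicted sides of its two endpoints. -/
structure AnnotatedUpdate (n : ℕ) where
  update : EdgeUpdate n
  predU : Bool
  predV : Bool

/-- The stream as the algorithm sees it when the prediction vector is `y`. -/
def annotate {n : ℕ} (y : Fin n → Bool) (σ : List (EdgeUpdate n)) : List (AnnotatedUpdate n) :=
  σ.map fun a => ⟨a, y a.u, y a.v⟩

/-- The value of the cut `({v | x v = true}, {v | x v = false})`: the number of edges it cuts. -/
noncomputable def cutValue {n : ℕ} (G : SimpleGraph (Fin n)) (x : Fin n → Bool) : ℕ :=
  {e : Sym2 (Fin n) | ∃ u v, G.Adj u v ∧ x u ≠ x v ∧ e = s(u, v)}.ncard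

/-- The MAX-CUT value of `G`. -/
noncomputable def maxCut {n : ℕ} (G : SimpleGraph (Fin n)) : ℕ :=
  Finset.univ.sup (cutValue G)

/-- A randomized single-pass streaming algorithm that reads items of type `α` and uses `s` bits of
space: its whole memory, including any random bits that it wants to reuse later, is a string of `s`
bits. It is initialized at random, each arriving item changes it at random (with fresh coins), and
the estimate is read off the final memory content. -/
structure StreamingAlgorithm (α : Type) (s : ℕ) where
  init : PMF (Fin s → Bool)
  step : (Fin s → Bool) → α → PMF (Fin s → Bool)
  output : (Fin s → Bool) → ℝ

/-- The law of the memory content after one pass over the stream. -/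
noncomputable def StreamingAlgorithm.run {α : Type} {s : ℕ} (A : StreamingAlgorithm α s)
    (σ : List α) : PMF (Fin s → Bool) :=
  σ.foldl (fun p a => p.bind fun mem => A.step mem a) A.init

/-- The law of the estimate that is returned after one pass over the stream. -/
noncomputable def StreamingAlgorithm.outputLaw {α : Type} {s : ℕ} (A : StreamingAlgorithm α s)
    (σ : List α) : PMF ℝ :=
  (A.run σ).map A.output

/-- The random vector `Y` is an `ε`-accurate prediction of `x`: its entries are independent, and
each is correct with probability `1/2 + ε` (hence wrong with probability `1/2 - ε`). -/
structure IsAccuratePrediction {Ω : Type*} [MeasurableSpace Ω] (μ : Measure Ω) {n : ℕ}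
    (Y : Fin n → Ω → Bool) (x : Fin n → Bool) (ε : ℝ) : Prop where
  measurable : ∀ v, Measurable (Y v)
  indep : iIndepFun Y μ
  accurate : ∀ v, μ.real {ω | Y v ω = x v} = 1 / 2 + ε

/-- The probability, over the predictions `Y` and the independent internal coins of `A`, that `A`
returns an estimate in `I` on the stream `σ` annotated with the predictions. -/
noncomputable def estimateProb {Ω : Type*} [MeasurableSpace Ω] (μ : Measure Ω) {n s : ℕ}
    (A : StreamingAlgorithm (AnnotatedUpdate n) s) (Y : Fin n → Ω → Bool)
    (σ : List (EdgeUpdate n)) (I : Set ℝ) : ENNReal :=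
  ∫⁻ ω, (A.outputLaw (annotate (fun v => Y v ω) σ)).toOuterMeasure I ∂μ

/-!
The algorithm is a linear sketch, so deletions cost nothing. It maintains the number `m` of edges,
the number of edges cut by the prediction `Y`, and, for each sampling rate `2 ^ (-j)`, enough power
sums over a field of characteristic two to recover the annotated edges sampled at that rate,
provided that they are few (`eq_of_powerSums_eq`). The samples are chosen by a pairwise independent
affine hash of the edge alone, so that they are independent of `Y`. Counters are kept modulo a
number above the number of edges, which suffices because only the final graph matters
(`IsDynamicStream.sum_sign_smul`).

Following the prediction everywhere would cut `(1/2 + 2 ε²) OPT` edges in expectation, since an edge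
of the optimal cut is cut with probability `1/2 + 2 ε²` and the others can only help. However, the
variance may be huge: the wrong prediction of one vertex of very large degree spoils the cut. Hence
the heavy vertices, those whose sampled degree is at least `θ m`, are treated separately. The
estimate is the predicted cut plus the positive parts of the estimated gains of the heavy vertices,
where the gain of a vertex is the increase of the cut when it changes sides, minus a slack `l m`.

There are at most `4 / θ` heavy vertices, so the edges among them are negligible, and up to this
error the flips act independently (`cutValue_flip`). Therefore the estimate is at most `OPT`
(`cutValue_add_gain_le_maxCut`), and it is at least the value of the cut that follows the optimal
cut on the heavy vertices and the prediction elsewhere (`cutValue_piecewise_le`). That last cut has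
small variance because only light vertices are random in it: its variance is of order
`ε² θ m² + m / θ`, where the second term is negligible for large `m`, and Chebyshev's inequality
(`IsAccuratePrediction.cut_tail`) applies with `θ` of order `ε² δ`.

The sampling error is controlled by a single second moment, the sum over all vertices of the squared
errors of degree and gain (`sum_sqError_le`). It bounds the error of each degree, which makes the
heavy set correct, and by the Cauchy–Schwarz inequality also the total error of the gains of the
heavy vertices. A sample of order `1 / (ε ^ 6 δ ^ 3)` edges is enough, and each of its elements
costs `O(log n)` bits at each of the `O(log n)` sampling rates.
-/

/-! ### Linear sketches as streaming algorithms -/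

/-- The algorithm that keeps a random seed `r : R` and the running sum in `V` of the
contributions `φ r a` of the items `a` read so far; `enc` stores seed and sum in `s` bits. -/
noncomputable def sketchAlgorithm {α R V : Type} {s : ℕ} [Fintype R] [Nonempty R]
    [AddCommGroup V] (enc : R × V ↪ (Fin s → Bool)) (φ : R → α → V) (out : R × V → ℝ) :
    StreamingAlgorithm α s where
  init := (PMF.uniformOfFintype R).map fun r => enc (r, 0)
  step mem a :=
    let p := Function.invFun enc mem
    PMF.pure (enc (p.1, p.2 + φ p.1 a))
  output mem := out (Function.invFun enc mem)

theorem sketchAlgorithm_run {α R V : Type} {s : ℕ} [Fintype R] [Nonempty R]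
    [AddCommGroup V] (enc : R × V ↪ (Fin s → Bool)) (φ : R → α → V) (out : R × V → ℝ)
    (σ : List α) :
    (sketchAlgorithm enc φ out).run σ =
      (PMF.uniformOfFintype R).map fun r => enc (r, (σ.map (φ r)).sum) := by
  induction σ using List.reverseRecOn with
  | nil => simp [StreamingAlgorithm.run, sketchAlgorithm]
  | append_singleton l a ih =>
    unfold StreamingAlgorithm.run at ih ⊢
    rw [List.foldl_append, ih, List.foldl_cons, List.foldl_nil, PMF.bind_map, ← PMF.bind_pure_comp]
    congr 1
    funext r
    simp [sketchAlgorithm, Function.leftInverse_invFun enc.injective (r, _)]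

theorem sketchAlgorithm_outputLaw {α R V : Type} {s : ℕ} [Fintype R] [Nonempty R]
    [AddCommGroup V] (enc : R × V ↪ (Fin s → Bool)) (φ : R → α → V) (out : R × V → ℝ)
    (σ : List α) :
    (sketchAlgorithm enc φ out).outputLaw σ =
      (PMF.uniformOfFintype R).map fun r => out (r, (σ.map (φ r)).sum) := by
  rw [StreamingAlgorithm.outputLaw, sketchAlgorithm_run, PMF.map_comp]
  congr 1
  funext r
  simp [sketchAlgorithm, Function.leftInverse_invFun enc.injective (r, _)]

open Classical in
/-- The sum over a dynamic stream of the signed contributions of its items is the sum of the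
contributions of the edges of the final graph. -/
theorem IsDynamicStream.sum_sign_smul {n : ℕ} {V : Type*} [AddCommGroup V]
    {σ : List (EdgeUpdate n)} {G : SimpleGraph (Fin n)} (h : IsDynamicStream σ G)
    (f : Sym2 (Fin n) → V) :
    (σ.map fun a => a.sign • f s(a.u, a.v)).sum = ∑ e ∈ G.edgeFinset, f e := by
  have key : ∀ τ : List (EdgeUpdate n),
      (τ.map fun a => a.sign • f s(a.u, a.v)).sum = ∑ e, netMultiplicity τ e • f e := by
    intro τ
    induction τ with
    | nil => simp [netMultiplicity]
    | cons a τ ih =>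
      simp only [List.map_cons, List.sum_cons, ih, netMultiplicity, add_smul,
        Finset.sum_add_distrib, ite_smul, zero_smul]
      simp
  rw [key, ← Finset.sum_subset (Finset.subset_univ G.edgeFinset)]
  · refine Finset.sum_congr rfl fun e he => ?_
    rw [(h.2 e).1 (by simpa using he), one_smul]
  · intro e _ he
    rw [(h.2 e).2 (by simpa using he), zero_smul]

/-- The probability of an outcome is bounded through the expected fraction of bad seeds. -/
theorem le_lintegral_uniform_map {Ω : Type*} [MeasurableSpace Ω] (μ : Measure Ω)
    [IsProbabilityMeasure μ] {R : Type} [Fintype R] [Nonempty R] (o : R → Ω → ℝ) (I : Set ℝ)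
    (δ : ℝ) (hm : ∀ r, MeasurableSet {ω | o r ω ∉ I})
    (hbad : ∑ r, μ.real {ω | o r ω ∉ I} ≤ δ * Fintype.card R) :
    ENNReal.ofReal (1 - δ) ≤
      ∫⁻ ω, ((PMF.uniformOfFintype R).map fun r => o r ω).toOuterMeasure I ∂μ := by
  classical
  have h1 : ∀ ω, ((PMF.uniformOfFintype R).map fun r => o r ω).toOuterMeasure I =
      ∑ r, ({ω | o r ω ∈ I}.indicator (fun _ => (Fintype.card R : ENNReal)⁻¹) ω) := by
    intro ω
    rw [PMF.toOuterMeasure_map_apply, PMF.toOuterMeasure_apply_fintype]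
    refine Finset.sum_congr rfl fun r _ => ?_
    simp [Set.indicator_apply]
  have hc : (0 : ℝ) < Fintype.card R := by exact_mod_cast Fintype.card_pos
  have hm' : ∀ r, MeasurableSet {ω | o r ω ∈ I} := fun r => by
    simpa [Set.compl_ofPred] using (hm r).compl
  simp_rw [h1]
  rw [lintegral_finsetSum _ fun r _ => measurable_const.indicator (hm' r)]
  simp_rw [lintegral_indicator_const (hm' _)]
  rw [← Finset.mul_sum]
  have h2 : ∑ r, μ {ω | o r ω ∈ I} = ENNReal.ofReal (∑ r, μ.real {ω | o r ω ∈ I}) := by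
    rw [ENNReal.ofReal_sum_of_nonneg fun _ _ => measureReal_nonneg]
    simp
  have h3 : ∀ r, μ.real {ω | o r ω ∈ I} = 1 - μ.real {ω | o r ω ∉ I} := fun r => by
    have := probReal_compl_eq_one_sub (μ := μ) (hm r)
    simpa [Set.compl_ofPred] using this
  rw [h2, show (Fintype.card R : ENNReal)⁻¹ = ENNReal.ofReal ((Fintype.card R : ℝ)⁻¹) by
    rw [ENNReal.ofReal_inv_of_pos hc, ENNReal.ofReal_natCast],
    ← ENNReal.ofReal_mul (by positivity)]
  refine ENNReal.ofReal_le_ofReal ?_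
  simp_rw [h3]
  rw [Finset.sum_sub_distrib, Finset.sum_const, Finset.card_univ, nsmul_eq_mul, mul_one,
    inv_mul_eq_div, le_div_iff₀ hc]
  linarith

/-! ### Power sums and pairwise independent hashing -/

/-- A set of at most `t` points of a field is determined by its first `2 t` power sums. -/
theorem eq_of_powerSums_eq {U F : Type*} [DecidableEq U] [Field F] (code : U ↪ F) {t : ℕ}
    {S S' : Finset U} (hS : S.card ≤ t) (hS' : S'.card ≤ t)
    (h : ∀ i < 2 * t, ∑ e ∈ S, code e ^ i = ∑ e ∈ S', code e ^ i) : S = S' := by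
  have hpoly : ∀ P : Polynomial F, P.natDegree < 2 * t →
      ∑ e ∈ S, P.eval (code e) = ∑ e ∈ S', P.eval (code e) := by
    intro P hP
    simp_rw [Polynomial.eval_eq_sum_range]
    rw [Finset.sum_comm, Finset.sum_comm (s := S')]
    refine Finset.sum_congr rfl fun i hi => ?_
    rw [← Finset.mul_sum, ← Finset.mul_sum, h i (by grind)]
  -- A point of one set only is isolated by the polynomial vanishing at all the other points.
  have key : ∀ e₀, (e₀ ∈ S ∪ S') → (e₀ ∈ S ↔ e₀ ∈ S') := by
    intro e₀ he₀
    set P : Polynomial F :=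
      ∏ e ∈ (S ∪ S').erase e₀, (Polynomial.X - Polynomial.C (code e)) with hP
    have hdeg : P.natDegree < 2 * t := by
      rw [hP, Polynomial.natDegree_prod_of_monic _ _ fun e _ => Polynomial.monic_X_sub_C _]
      simp only [Polynomial.natDegree_X_sub_C, Finset.sum_const, smul_eq_mul, mul_one]
      have := Finset.card_erase_lt_of_mem he₀
      have := Finset.card_union_le S S'
      omega
    have hne : P.eval (code e₀) ≠ 0 := by
      rw [hP, Polynomial.eval_prod, Finset.prod_ne_zero_iff]
      intro e he
      simp only [Polynomial.eval_sub, Polynomial.eval_X, Polynomial.eval_C, sub_ne_zero]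
      exact fun hc => (Finset.ne_of_mem_erase he) (code.injective hc).symm
    have hz : ∀ e ∈ S ∪ S', e ≠ e₀ → P.eval (code e) = 0 := by
      intro e he hne'
      rw [hP, Polynomial.eval_prod]
      exact Finset.prod_eq_zero (Finset.mem_erase.2 ⟨hne', he⟩) (by simp)
    have hsum : ∀ A ⊆ S ∪ S', ∑ e ∈ A, P.eval (code e) =
        if e₀ ∈ A then P.eval (code e₀) else 0 := by
      intro A hA
      rw [← Finset.sum_ite_eq' A e₀ fun e => P.eval (code e)]
      refine Finset.sum_congr rfl fun e he => ?_
      split_ifs with h'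
      · rfl
      · exact hz e (hA he) h'
    have := hpoly P hdeg
    rw [hsum S Finset.subset_union_left, hsum S' Finset.subset_union_right] at this
    by_cases h1 : e₀ ∈ S <;> by_cases h2 : e₀ ∈ S' <;> simp_all
  ext e
  exact ⟨fun he => (key e (by simp [he])).1 he, fun he => (key e (by simp [he])).2 he⟩

open Classical in
/-- The indicator that the affine hash `x ↦ a x + b` sends the key `x` into `T`. -/
noncomputable def hashInd {F : Type*} [Field F] (T : Finset F) (r : F × F) (x : F) : ℝ :=
  if r.1 * x + r.2 ∈ T then 1 else 0

section Hash

variable {F : Type*} [Field F] [Fintype F]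

theorem sum_hash_one (f : F → ℝ) (x : F) :
    ∑ r : F × F, f (r.1 * x + r.2) = Fintype.card F * ∑ z, f z := by
  rw [Fintype.sum_prod_type]
  simp only
  have : ∀ a : F, ∑ b, f (a * x + b) = ∑ z, f z := fun a =>
    Equiv.sum_comp (Equiv.addLeft (a * x)) f
  simp [this]

/-- Distinct keys have independent hashes. -/
theorem sum_hash_two (f g : F → ℝ) {x y : F} (hxy : x ≠ y) :
    ∑ r : F × F, f (r.1 * x + r.2) * g (r.1 * y + r.2) = (∑ z, f z) * ∑ z, g z := by
  have hinj : Function.Injective fun r : F × F => (r.1 * x + r.2, r.1 * y + r.2) := by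
    rintro ⟨a, b⟩ ⟨a', b'⟩ h
    simp only [Prod.mk.injEq] at h ⊢
    have h1 : (a - a') * (x - y) = 0 := by linear_combination h.1 - h.2
    have h2 : a = a' := by
      rcases mul_eq_zero.1 h1 with h | h
      · exact sub_eq_zero.1 h
      · exact absurd (sub_eq_zero.1 h) hxy
    exact ⟨h2, by subst h2; exact add_left_cancel h.1⟩
  have := (Equiv.ofBijective _ (Finite.injective_iff_bijective.1 hinj)).sum_comp
    (fun z : F × F => f z.1 * g z.2)
  simp only [Equiv.ofBijective_apply] at this
  rw [this, Fintype.sum_prod_type, Finset.sum_mul_sum]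

/-- Second moment of a weighted sum of centred sampling indicators. -/
theorem sum_hash_sq_le {ι : Type*} (s : Finset ι) (key : ι → F) (hkey : Set.InjOn key s)
    (T : Finset F) (c : ι → ℝ) :
    ∑ r : F × F, (∑ i ∈ s, c i * (hashInd T r (key i) - T.card / Fintype.card F)) ^ 2 ≤
      (Fintype.card (F × F) : ℝ) * (T.card / Fintype.card F * ∑ i ∈ s, c i ^ 2) := by
  classical
  set q : ℝ := (Fintype.card F : ℝ) with hq
  have hq0 : 0 < q := by simp only [hq]; exact_mod_cast Fintype.card_pos
  set p : ℝ := T.card / q with hp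
  set f : F → ℝ := fun z => (if z ∈ T then 1 else 0) - p with hf
  have hp0 : 0 ≤ p := by positivity
  have hf0 : ∑ z, f z = 0 := by
    simp only [hf, Finset.sum_sub_distrib, Finset.sum_ite_mem, Finset.univ_inter,
      Finset.sum_const, Finset.card_univ, nsmul_eq_mul, mul_one, hp]
    field_simp
    simp [hq]
  have hf2 : ∑ z, f z ^ 2 ≤ q * p := by
    have : ∀ z, f z ^ 2 = (1 - 2 * p) * (if z ∈ T then 1 else 0) + p ^ 2 := by
      intro z; simp only [hf]; split_ifs <;> ring
    simp only [this, Finset.sum_add_distrib, ← Finset.mul_sum, Finset.sum_ite_mem,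
      Finset.univ_inter, Finset.sum_const, Finset.card_univ, nsmul_eq_mul, mul_one]
    have hT : (T.card : ℝ) = q * p := by rw [hp]; field_simp
    rw [hT, ← hq]
    nlinarith [mul_nonneg hq0.le (sq_nonneg p)]
  have hrw : ∀ r : F × F, ∀ i, hashInd T r (key i) - p = f (r.1 * key i + r.2) := by
    intro r i; simp [hashInd, hf]
  simp_rw [hrw, sq (Finset.sum _ _), Finset.sum_mul_sum]
  rw [Finset.sum_comm]
  have hterm : ∀ i ∈ s, ∑ r : F × F, ∑ j ∈ s,
      c i * f (r.1 * key i + r.2) * (c j * f (r.1 * key j + r.2)) ≤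
        c i ^ 2 * (q * (q * p)) := by
    intro i hi
    rw [Finset.sum_comm, Finset.sum_eq_single i]
    · have : ∀ r : F × F, c i * f (r.1 * key i + r.2) * (c i * f (r.1 * key i + r.2)) =
          c i ^ 2 * (fun z => f z ^ 2) (r.1 * key i + r.2) := fun r => by ring
      simp_rw [this]
      rw [← Finset.mul_sum, sum_hash_one fun z => f z ^ 2]
      gcongr
    · intro j hj hji
      have : ∀ r : F × F, c i * f (r.1 * key i + r.2) * (c j * f (r.1 * key j + r.2)) =
          (c i * c j) * (f (r.1 * key i + r.2) * f (r.1 * key j + r.2)) := fun r => by ring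
      simp_rw [this]
      rw [← Finset.mul_sum, sum_hash_two f f fun h => hji (hkey hj hi h.symm), hf0]
      simp
    · exact fun h => absurd hi h
  refine (Finset.sum_le_sum hterm).trans (le_of_eq ?_)
  rw [← Finset.sum_mul, Fintype.card_prod]
  push_cast
  ring

end Hash

/-! ### Cuts, gains and flips -/

/-- The sign `±1` of a side of a cut. -/
def sgn (b : Bool) : ℝ := if b then 1 else -1

theorem sgn_mul_self (b : Bool) : sgn b * sgn b = 1 := by cases b <;> simp [sgn]

theorem abs_sgn (b : Bool) : |sgn b| = 1 := by cases b <;> simp [sgn]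

section Cuts

variable {n : ℕ} (G : SimpleGraph (Fin n))

open Classical in
/-- The entries of the adjacency matrix, as real numbers. -/
noncomputable def adjInd (u v : Fin n) : ℝ := if G.Adj u v then 1 else 0

theorem adjInd_nonneg (u v : Fin n) : 0 ≤ adjInd G u v := by
  unfold adjInd; split_ifs <;> simp

theorem adjInd_le_one (u v : Fin n) : adjInd G u v ≤ 1 := by
  unfold adjInd; split_ifs <;> simp

theorem adjInd_sq (u v : Fin n) : adjInd G u v ^ 2 = adjInd G u v := by
  unfold adjInd; split_ifs <;> simp

theorem adjInd_comm (u v : Fin n) : adjInd G u v = adjInd G v u := by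
  by_cases h : G.Adj u v
  · simp [adjInd, h, h.symm]
  · have h' : ¬ G.Adj v u := fun h' => h h'.symm
    simp [adjInd, h, h']

theorem adjInd_self (u : Fin n) : adjInd G u u = 0 := by simp [adjInd]

/-- The degree of `v`, as a real number. -/
noncomputable def degR (v : Fin n) : ℝ := ∑ w, adjInd G v w

/-- The signed degree of `v`: uncut minus cut edges at `v`, which is the increase of the cut when
`v` changes sides. -/
noncomputable def gain (y : Fin n → Bool) (v : Fin n) : ℝ :=
  ∑ w, adjInd G v w * (sgn (y v) * sgn (y w))

theorem degR_nonneg (v : Fin n) : 0 ≤ degR G v :=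
  Finset.sum_nonneg fun _ _ => adjInd_nonneg G _ _

theorem sum_degR : ∑ v, degR G v = 2 * (G.edgeSet.ncard : ℝ) := by
  classical
  have h := G.sum_degrees_eq_twice_card_edges
  have h2 : G.edgeSet.ncard = G.edgeFinset.card := by
    rw [← SimpleGraph.coe_edgeFinset, Set.ncard_coe_finset]
  rw [h2]
  have h3 : ∀ v, degR G v = (G.degree v : ℝ) := by
    intro v
    simp [degR, adjInd, ← SimpleGraph.card_neighborFinset_eq_degree,
      SimpleGraph.neighborFinset_eq_filter]
  simp_rw [h3]
  exact_mod_cast h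

theorem four_mul_cutValue (x : Fin n → Bool) :
    4 * (cutValue G x : ℝ) = ∑ u, ∑ v, adjInd G u v * (1 - sgn (x u) * sgn (x v)) := by
  classical
  let G' : SimpleGraph (Fin n) :=
    { Adj := fun u v => G.Adj u v ∧ x u ≠ x v
      symm := ⟨fun u v h => ⟨h.1.symm, h.2.symm⟩⟩
      loopless := ⟨fun u h => h.2 rfl⟩ }
  have h1 : {e : Sym2 (Fin n) | ∃ u v, G.Adj u v ∧ x u ≠ x v ∧ e = s(u, v)} = G'.edgeSet := by
    ext e
    induction e with
    | h a b =>
      constructor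
      · rintro ⟨u, v, h, h', he⟩
        rw [he]
        exact ⟨h, h'⟩
      · intro h
        exact ⟨a, b, h.1, h.2, rfl⟩
  rw [cutValue, h1, show (4 : ℝ) * (G'.edgeSet.ncard : ℝ) = 2 * (2 * (G'.edgeSet.ncard : ℝ)) by ring,
    ← sum_degR, Finset.mul_sum]
  refine Finset.sum_congr rfl fun u _ => ?_
  rw [degR, Finset.mul_sum]
  refine Finset.sum_congr rfl fun v _ => ?_
  by_cases h : G.Adj u v <;> rcases hu : x u <;> rcases hv : x v <;>
    norm_num [adjInd, G', h, hu, hv, sgn]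

theorem cutValue_le_maxCut (x : Fin n → Bool) : cutValue G x ≤ maxCut G :=
  Finset.le_sup (Finset.mem_univ x)

/-- Flipping the set `F` changes the cut by the gains of its vertices, up to the edges inside `F`. -/
theorem cutValue_flip (y : Fin n → Bool) (F : Finset (Fin n)) :
    (cutValue G (fun v => if v ∈ F then !y v else y v) : ℝ) =
      cutValue G y + ∑ v ∈ F, gain G y v -
        ∑ u ∈ F, ∑ v ∈ F, adjInd G u v * (sgn (y u) * sgn (y v)) := by
  set f : Fin n → ℝ := fun v => if v ∈ F then 1 else 0 with hf
  have hs : ∀ v, sgn (if v ∈ F then !y v else y v) = sgn (y v) * (1 - 2 * f v) := by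
    intro v
    simp only [hf]
    split_ifs <;> rcases y v <;> norm_num [sgn]
  have hsum : ∀ g : Fin n → ℝ, ∑ u ∈ F, g u = ∑ u, f u * g u := by
    intro g
    simp only [hf, ite_mul, one_mul, zero_mul, Finset.sum_ite_mem, Finset.univ_inter]
  have h1 : ∑ v ∈ F, gain G y v = ∑ u, ∑ v, f u * (adjInd G u v * (sgn (y u) * sgn (y v))) := by
    rw [hsum]
    refine Finset.sum_congr rfl fun u _ => ?_
    rw [gain, Finset.mul_sum]
  have h2 : ∑ v ∈ F, gain G y v = ∑ u, ∑ v, f v * (adjInd G u v * (sgn (y u) * sgn (y v))) := by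
    rw [h1, Finset.sum_comm]
    refine Finset.sum_congr rfl fun u _ => Finset.sum_congr rfl fun v _ => ?_
    rw [adjInd_comm]; ring
  have h3 : ∑ u ∈ F, ∑ v ∈ F, adjInd G u v * (sgn (y u) * sgn (y v)) =
      ∑ u, ∑ v, f u * f v * (adjInd G u v * (sgn (y u) * sgn (y v))) := by
    rw [hsum]
    refine Finset.sum_congr rfl fun u _ => ?_
    rw [hsum, Finset.mul_sum]
    exact Finset.sum_congr rfl fun v _ => by ring
  have h4 := four_mul_cutValue G (fun v => if v ∈ F then !y v else y v)
  have h5 := four_mul_cutValue G y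
  have h6 : ∑ u, ∑ v, adjInd G u v * (1 - sgn (if u ∈ F then !y u else y u) *
      sgn (if v ∈ F then !y v else y v)) =
      ∑ u, ∑ v, adjInd G u v * (1 - sgn (y u) * sgn (y v)) +
      2 * ∑ u, ∑ v, f u * (adjInd G u v * (sgn (y u) * sgn (y v))) +
      2 * ∑ u, ∑ v, f v * (adjInd G u v * (sgn (y u) * sgn (y v))) -
      4 * ∑ u, ∑ v, f u * f v * (adjInd G u v * (sgn (y u) * sgn (y v))) := by
    simp only [Finset.mul_sum, ← Finset.sum_add_distrib, ← Finset.sum_sub_distrib]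
    refine Finset.sum_congr rfl fun u _ => Finset.sum_congr rfl fun v _ => ?_
    rw [hs, hs]; ring
  rw [h6, ← h5, ← h1, ← h2, ← h3] at h4
  linarith

theorem abs_inner_le (y : Fin n → Bool) (F : Finset (Fin n)) :
    |∑ u ∈ F, ∑ v ∈ F, adjInd G u v * (sgn (y u) * sgn (y v))| ≤ (F.card : ℝ) ^ 2 := by
  have h : ∀ u ∈ F, |∑ v ∈ F, adjInd G u v * (sgn (y u) * sgn (y v))| ≤ (F.card : ℝ) := by
    intro u _
    refine (Finset.abs_sum_le_sum_abs _ _).trans ?_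
    refine (Finset.sum_le_card_nsmul _ _ 1 fun v _ => ?_).trans (by simp)
    rw [abs_mul, abs_mul, abs_sgn, abs_sgn, abs_of_nonneg (adjInd_nonneg G u v)]
    simpa using adjInd_le_one G u v
  refine (Finset.abs_sum_le_sum_abs _ _).trans ((Finset.sum_le_card_nsmul _ _ _ h).trans ?_)
  rw [nsmul_eq_mul, sq]

/-- Flipping exactly the vertices of `H` with positive gain yields a genuine cut. -/
theorem cutValue_add_gain_le_maxCut (y : Fin n → Bool) (H : Finset (Fin n)) :
    (cutValue G y : ℝ) + ∑ v ∈ H, max 0 (gain G y v) ≤ maxCut G + (H.card : ℝ) ^ 2 := by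
  set F := H.filter fun v => 0 < gain G y v with hF
  have h1 : ∑ v ∈ H, max 0 (gain G y v) = ∑ v ∈ F, gain G y v := by
    rw [hF, Finset.sum_filter]
    refine Finset.sum_congr rfl fun v _ => ?_
    split_ifs with h
    · exact max_eq_right h.le
    · exact max_eq_left (not_lt.1 h)
  have h2 := cutValue_flip G y F
  have h3 := (abs_le.1 (abs_inner_le G y F)).2
  have h4 : ((cutValue G fun v => if v ∈ F then !y v else y v : ℕ) : ℝ) ≤ maxCut G :=
    Nat.cast_le.2 (cutValue_le_maxCut G _)
  have h5 : (F.card : ℝ) ^ 2 ≤ (H.card : ℝ) ^ 2 := by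
    have : F.card ≤ H.card := Finset.card_filter_le _ _
    gcongr
  linarith

/-- Any reassignment of the vertices of `H` is dominated by flipping those with positive gain. -/
theorem cutValue_piecewise_le (x y : Fin n → Bool) (H : Finset (Fin n)) :
    (cutValue G (fun v => if v ∈ H then x v else y v) : ℝ) ≤
      cutValue G y + ∑ v ∈ H, max 0 (gain G y v) + (H.card : ℝ) ^ 2 := by
  set F := H.filter fun v => x v ≠ y v with hF
  have h0 : (fun v => if v ∈ H then x v else y v) = fun v => if v ∈ F then !y v else y v := by
    funext v
    by_cases h : v ∈ H <;> cases hx : x v <;> cases hy : y v <;> simp [hF, h, hx, hy]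
  have h1 : ∑ v ∈ F, gain G y v ≤ ∑ v ∈ H, max 0 (gain G y v) :=
    (Finset.sum_le_sum fun v _ => le_max_right 0 _).trans
      (Finset.sum_le_sum_of_subset_of_nonneg (Finset.filter_subset _ _)
        fun _ _ _ => le_max_left _ _)
  have h2 := cutValue_flip G y F
  have h3 := (abs_le.1 (abs_inner_le G y F)).1
  have h5 : (F.card : ℝ) ^ 2 ≤ (H.card : ℝ) ^ 2 := by
    have : F.card ≤ H.card := Finset.card_filter_le _ _
    gcongr
  rw [h0]
  linarith

/-- A maximum cut has no vertex of positive gain, so it contains at least half of the edges. -/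
theorem ncard_le_two_mul_maxCut : (G.edgeSet.ncard : ℝ) ≤ 2 * maxCut G := by
  obtain ⟨x, -, hx⟩ := Finset.exists_mem_eq_sup (Finset.univ : Finset (Fin n → Bool))
    ⟨fun _ => true, Finset.mem_univ _⟩ (cutValue G)
  have hx' : maxCut G = cutValue G x := hx
  have hg : ∀ v, gain G x v ≤ 0 := by
    intro v
    have h := cutValue_flip G x {v}
    simp only [Finset.sum_singleton, adjInd_self, zero_mul, sub_zero] at h
    have h4 : ((cutValue G fun w => if w ∈ ({v} : Finset (Fin n)) then !x w else x w : ℕ) : ℝ) ≤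
      maxCut G := Nat.cast_le.2 (cutValue_le_maxCut G _)
    rw [hx'] at h4
    linarith
  have h1 := four_mul_cutValue G x
  have h2 : ∑ u, ∑ v, adjInd G u v * (1 - sgn (x u) * sgn (x v)) =
      ∑ v, degR G v - ∑ v, gain G x v := by
    simp only [degR, gain, ← Finset.sum_sub_distrib]
    refine Finset.sum_congr rfl fun u _ => Finset.sum_congr rfl fun v _ => by ring
  have h3 : ∑ v, gain G x v ≤ 0 := Finset.sum_nonpos fun v _ => hg v
  rw [h2, sum_degR] at h1
  rw [hx']
  linarith

end Cuts

/-! ### Quadratic forms in the predictions -/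

section RandomCut

variable {n : ℕ} (G : SimpleGraph (Fin n))

/-- Second moment of a quadratic polynomial without constant term in independent centred variables.
Only the diagonal terms of its linear part and the pairs of equal edges of its quadratic part
survive. -/
theorem integral_quadratic_sq_le (ν : Measure (Fin n → Bool)) [IsProbabilityMeasure ν]
    (ζ : Fin n → Bool → ℝ) (hζ : ∀ u b, |ζ u b| ≤ 2)
    (h0 : ∀ u (f : (Fin n → Bool) → ℝ), (∀ y b, f (Function.update y u b) = f y) →
      ∫ y, f y * ζ u (y u) ∂ν = 0) (L : Finset (Fin n)) (b : Fin n → ℝ) :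
    ∫ y, (2 * ∑ v ∈ L, b v * ζ v (y v) +
        ∑ u, ∑ v, adjInd G u v * (ζ u (y u) * ζ v (y v))) ^ 2 ∂ν ≤
      32 * ∑ v ∈ L, b v ^ 2 + 128 * (G.edgeSet.ncard : ℝ) := by
  have hint : ∀ f : (Fin n → Bool) → ℝ, Integrable f ν := fun f => .of_finite
  have hle : ∀ (f : (Fin n → Bool) → ℝ) (c : ℝ), (∀ y, f y ≤ c) → ∫ y, f y ∂ν ≤ c := by
    intro f c h
    simpa using integral_mono (hint f) (hint fun _ => c) h
  have hsq : ∀ u b, ζ u b * ζ u b ≤ 4 := by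
    intro u b
    have := abs_le.1 (hζ u b)
    nlinarith
  have hB : ∫ y, (∑ v ∈ L, b v * ζ v (y v)) ^ 2 ∂ν ≤ 4 * ∑ v ∈ L, b v ^ 2 := by
    simp_rw [sq (Finset.sum _ _), Finset.sum_mul_sum]
    rw [integral_finsetSum _ fun _ _ => hint _, Finset.mul_sum]
    refine Finset.sum_le_sum fun u hu => ?_
    rw [integral_finsetSum _ fun _ _ => hint _, Finset.sum_eq_single u]
    · refine hle _ _ fun y => ?_
      nlinarith [hsq u (y u), sq_nonneg (b u)]
    · intro v _ hvu
      have := h0 u (fun y => b u * b v * ζ v (y v)) fun y c => by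
        rw [Function.update_of_ne hvu]
      rw [← this]
      congr 1
      funext y
      ring
    · exact fun h => absurd hu h
  have hQterm : ∀ u v w t, adjInd G u v * adjInd G w t *
      ∫ y, ζ u (y u) * ζ v (y v) * (ζ w (y w) * ζ t (y t)) ∂ν ≤
      16 * (adjInd G u v * ((if u = w then if v = t then 1 else 0 else 0) +
        if u = t then if v = w then 1 else 0 else 0)) := by
    intro u v w t
    have hA := adjInd_nonneg G u v
    have hA' := adjInd_nonneg G w t
    have hA1 := adjInd_le_one G w t
    by_cases huv : u = v
    · subst huv; simp [adjInd_self]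
    by_cases hwt : w = t
    · subst hwt
      rw [adjInd_self, mul_zero, zero_mul]
      split_ifs <;> positivity
    by_cases hp : (u = w ∧ v = t) ∨ (u = t ∧ v = w)
    · have h16 : ∫ y, ζ u (y u) * ζ v (y v) * (ζ w (y w) * ζ t (y t)) ∂ν ≤ 16 := by
        refine hle _ _ fun y => ?_
        have h1 := hsq u (y u)
        have h2 := hsq v (y v)
        have h3 := mul_self_nonneg (ζ u (y u))
        have h4 := mul_self_nonneg (ζ v (y v))
        rcases hp with ⟨rfl, rfl⟩ | ⟨rfl, rfl⟩ <;> nlinarith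
      have h1 : (1 : ℝ) ≤ (if u = w then if v = t then 1 else 0 else 0) +
          if u = t then if v = w then 1 else 0 else 0 := by
        rcases hp with ⟨rfl, rfl⟩ | ⟨rfl, rfl⟩ <;> simp <;> split_ifs <;> norm_num
      calc adjInd G u v * adjInd G w t *
            ∫ y, ζ u (y u) * ζ v (y v) * (ζ w (y w) * ζ t (y t)) ∂ν
          ≤ adjInd G u v * adjInd G w t * 16 := by gcongr
        _ ≤ adjInd G u v * 1 * 16 := by gcongr
        _ = 16 * (adjInd G u v * 1) := by ring
        _ ≤ _ := by gcongr
    · have hz : ∫ y, ζ u (y u) * ζ v (y v) * (ζ w (y w) * ζ t (y t)) ∂ν = 0 := by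
        -- Some vertex lies on exactly one of the two edges, and its variable factors out.
        by_cases hu : u ≠ w ∧ u ≠ t
        · have := h0 u (fun y => ζ v (y v) * (ζ w (y w) * ζ t (y t))) fun y c => by
            rw [Function.update_of_ne (Ne.symm huv), Function.update_of_ne hu.1.symm,
              Function.update_of_ne hu.2.symm]
          rw [← this]
          congr 1; funext y; ring
        · have hv : v ≠ w ∧ v ≠ t := by grind
          have := h0 v (fun y => ζ u (y u) * (ζ w (y w) * ζ t (y t))) fun y c => by
            rw [Function.update_of_ne huv, Function.update_of_ne hv.1.symm,
              Function.update_of_ne hv.2.symm]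
          rw [← this]
          congr 1; funext y; ring
      rw [hz, mul_zero]
      split_ifs <;> positivity
  have hQ : ∫ y, (∑ u, ∑ v, adjInd G u v * (ζ u (y u) * ζ v (y v))) ^ 2 ∂ν ≤
      64 * (G.edgeSet.ncard : ℝ) := by
    have h1 : ∀ y : Fin n → Bool, (∑ u, ∑ v, adjInd G u v * (ζ u (y u) * ζ v (y v))) ^ 2 =
        ∑ u, ∑ v, ∑ w, ∑ t, adjInd G u v * adjInd G w t *
          (ζ u (y u) * ζ v (y v) * (ζ w (y w) * ζ t (y t))) := by
      intro y
      simp_rw [sq, Finset.sum_mul, Finset.mul_sum]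
      refine Finset.sum_congr rfl fun u _ => Finset.sum_congr rfl fun v _ =>
        Finset.sum_congr rfl fun w _ => Finset.sum_congr rfl fun t _ => by ring
    simp_rw [h1]
    have h2 : ∫ y, ∑ u, ∑ v, ∑ w, ∑ t, adjInd G u v * adjInd G w t *
          (ζ u (y u) * ζ v (y v) * (ζ w (y w) * ζ t (y t))) ∂ν =
        ∑ u, ∑ v, ∑ w, ∑ t, adjInd G u v * adjInd G w t *
          ∫ y, ζ u (y u) * ζ v (y v) * (ζ w (y w) * ζ t (y t)) ∂ν := by
      rw [integral_finsetSum _ fun _ _ => hint _]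
      refine Finset.sum_congr rfl fun u _ => ?_
      rw [integral_finsetSum _ fun _ _ => hint _]
      refine Finset.sum_congr rfl fun v _ => ?_
      rw [integral_finsetSum _ fun _ _ => hint _]
      refine Finset.sum_congr rfl fun w _ => ?_
      rw [integral_finsetSum _ fun _ _ => hint _]
      refine Finset.sum_congr rfl fun t _ => ?_
      rw [integral_const_mul]
    rw [h2]
    refine (Finset.sum_le_sum fun u _ => Finset.sum_le_sum fun v _ => Finset.sum_le_sum fun w _ =>
      Finset.sum_le_sum fun t _ => hQterm u v w t).trans (le_of_eq ?_)
    have h3 : ∀ u v, ∑ w, ∑ t, 16 * (adjInd G u v *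
        ((if u = w then if v = t then 1 else 0 else 0) +
          if u = t then if v = w then 1 else 0 else 0)) = 32 * adjInd G u v := by
      intro u v
      simp only [← Finset.mul_sum, Finset.sum_add_distrib]
      have e1 : ∑ w, ∑ t, (if u = w then if v = t then (1 : ℝ) else 0 else 0) = 1 := by simp
      have e2 : ∑ w, ∑ t, (if u = t then if v = w then (1 : ℝ) else 0 else 0) = 1 := by simp
      rw [e1, e2]; ring
    simp_rw [h3, ← Finset.mul_sum]
    have := sum_degR G
    simp only [degR] at this
    rw [this]; ring
  calc ∫ y, (2 * ∑ v ∈ L, b v * ζ v (y v) +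
        ∑ u, ∑ v, adjInd G u v * (ζ u (y u) * ζ v (y v))) ^ 2 ∂ν
      ≤ ∫ y, (8 * (∑ v ∈ L, b v * ζ v (y v)) ^ 2 +
        2 * (∑ u, ∑ v, adjInd G u v * (ζ u (y u) * ζ v (y v))) ^ 2) ∂ν := by
        refine integral_mono (hint _) (hint _) fun y => ?_
        dsimp only
        nlinarith [sq_nonneg (2 * ∑ v ∈ L, b v * ζ v (y v) -
          ∑ u, ∑ v, adjInd G u v * (ζ u (y u) * ζ v (y v)))]
    _ ≤ _ := by
        rw [integral_add (hint _) (hint _), integral_const_mul, integral_const_mul]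
        linarith

theorem measurable_prediction {Ω : Type*} [MeasurableSpace Ω] {Y : Fin n → Ω → Bool}
    (hY : ∀ v, Measurable (Y v)) : Measurable fun ω v => Y v ω := measurable_pi_lambda _ hY

theorem IsAccuratePrediction.integral_sgn {Ω : Type*} [MeasurableSpace Ω] {μ : Measure Ω}
    [IsProbabilityMeasure μ] {Y : Fin n → Ω → Bool} {x : Fin n → Bool} {ε : ℝ}
    (h : IsAccuratePrediction μ Y x ε) (v : Fin n) :
    ∫ ω, (sgn (Y v ω) - 2 * ε * sgn (x v)) ∂μ = 0 := by
  have hm : MeasurableSet {ω | Y v ω = x v} := h.measurable v (measurableSet_singleton (x v))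
  have h1 : ∀ ω, sgn (Y v ω) - 2 * ε * sgn (x v) =
      {ω | Y v ω = x v}.indicator (fun _ => 2 * sgn (x v)) ω - (1 + 2 * ε) * sgn (x v) := by
    intro ω
    by_cases hω : Y v ω = x v
    · rw [Set.indicator_of_mem (by exact hω), hω]; ring
    · rw [Set.indicator_of_notMem (by exact hω)]
      have : sgn (Y v ω) = - sgn (x v) := by
        revert hω; cases Y v ω <;> cases x v <;> simp [sgn]
      rw [this]; ring
  simp_rw [h1]
  rw [integral_sub ((integrable_const _).indicator hm) (integrable_const _),
    integral_indicator_const _ hm, h.accurate v]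
  simp
  ring

/-- A centred function of one prediction is orthogonal to all functions of the others. -/
theorem IsAccuratePrediction.integral_mul_eq_zero {Ω : Type*} [MeasurableSpace Ω] {μ : Measure Ω}
    [IsProbabilityMeasure μ] {Y : Fin n → Ω → Bool} {x : Fin n → Bool} {ε : ℝ}
    (h : IsAccuratePrediction μ Y x ε) (u : Fin n) (ζ : Bool → ℝ) (hζ : ∫ ω, ζ (Y u ω) ∂μ = 0)
    (f : (Fin n → Bool) → ℝ) (hf : ∀ y b, f (Function.update y u b) = f y) :
    ∫ ω, f (fun v => Y v ω) * ζ (Y u ω) ∂μ = 0 := by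
  classical
  have hind := h.indep.indepFun_finset (Finset.univ.erase u) {u}
    (by simp) h.measurable
  let f' : (↥(Finset.univ.erase u) → Bool) → ℝ := fun r =>
    f fun t => if ht : t ∈ Finset.univ.erase u then r ⟨t, ht⟩ else true
  let ζ' : (↥({u} : Finset (Fin n)) → Bool) → ℝ := fun r => ζ (r ⟨u, by simp⟩)
  have hind' := hind.comp (φ := f') (ψ := ζ') (measurable_of_finite _) (measurable_of_finite _)
  have hf' : ∀ ω, f (fun v => Y v ω) = f' fun i => Y i ω := by
    intro ω
    rw [← hf (fun v => Y v ω) true]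
    simp only [f']
    congr 1
    funext t
    by_cases ht : t = u
    · subst ht; simp
    · simp [ht]
  have hm1 : Measurable (fun ω => f' fun i => Y i ω) :=
    (measurable_of_finite f').comp (measurable_pi_lambda _ fun i => h.measurable i)
  have hm2 : Measurable (fun ω => ζ (Y u ω)) := (measurable_of_finite ζ).comp (h.measurable u)
  have key := hind'.integral_mul_eq_mul_integral hm1.aestronglyMeasurable hm2.aestronglyMeasurable
  simp_rw [hf']
  have : ∫ ω, ζ (Y u ω) ∂μ = ∫ ω, (ζ' ∘ fun ω (i : ({u} : Finset (Fin n))) => Y i ω) ω ∂μ := rfl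
  rw [this] at hζ
  rw [hζ, mul_zero] at key
  exact key

end RandomCut

/-! ### The cut that is optimal on the heavy vertices -/

section Tail

variable {n : ℕ} (G : SimpleGraph (Fin n))

/-- If the vertices of `H` are placed as in an optimal cut `x` and all the others, which have degree
at most `B`, as predicted, then the resulting cut beats `(1/2 + 2 ε²) OPT` up to a small deviation
with good probability. The bound is Chebyshev's inequality. -/
theorem IsAccuratePrediction.cut_tail {Ω : Type*} [MeasurableSpace Ω] {μ : Measure Ω}
    [IsProbabilityMeasure μ] {Y : Fin n → Ω → Bool} {x : Fin n → Bool} {ε : ℝ}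
    (h : IsAccuratePrediction μ Y x ε) (hε : 0 < ε) (hε2 : ε ≤ 1 / 2)
    (hx : cutValue G x = maxCut G) (hm : 0 < (G.edgeSet.ncard : ℝ)) (H : Finset (Fin n)) {B : ℝ}
    (hB0 : 0 ≤ B) (hB : ∀ v ∉ H, degR G v ≤ B) :
    μ.real {ω | (cutValue G (fun v => if v ∈ H then x v else Y v ω) : ℝ) <
        (1 / 2 + 2 * ε ^ 2) * maxCut G - ε ^ 2 * G.edgeSet.ncard / 4} ≤
      (128 * H.card + 512 * ε ^ 2 * B + 128) / (ε ^ 4 * G.edgeSet.ncard) := by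
  classical
  set m : ℝ := (G.edgeSet.ncard : ℝ) with hmdef
  have hYm := measurable_prediction h.measurable
  set ν : Measure (Fin n → Bool) := μ.map fun ω v => Y v ω with hν
  have : IsProbabilityMeasure ν := Measure.isProbabilityMeasure_map hYm.aemeasurable
  set L : Finset (Fin n) := Finset.univ \ H with hL
  -- The sign of the side of `v` is its mean `a v` plus the centred variable `ζ v`.
  let ζ : Fin n → Bool → ℝ := fun v b => if v ∈ H then 0 else sgn b - 2 * ε * sgn (x v)
  let a : Fin n → ℝ := fun v => if v ∈ H then sgn (x v) else 2 * ε * sgn (x v)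
  let b : Fin n → ℝ := fun v => ∑ w, adjInd G v w * a w
  let D : (Fin n → Bool) → ℝ := fun y => 2 * ∑ v ∈ L, b v * ζ v (y v) +
        ∑ u, ∑ v, adjInd G u v * (ζ u (y u) * ζ v (y v))
  have hζ : ∀ u b, |ζ u b| ≤ 2 := by
    intro u b
    simp only [ζ]
    split_ifs
    · simp
    · rw [abs_le]
      cases b <;> cases x u <;> simp [sgn] <;> constructor <;> linarith
  have hζ0 : ∀ u, ∫ ω, ζ u (Y u ω) ∂μ = 0 := by
    intro u
    simp only [ζ]
    split_ifs
    · simp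
    · exact h.integral_sgn u
  have hint : ∫ y, D y ^ 2 ∂ν ≤ 32 * ∑ v ∈ L, b v ^ 2 + 128 * m := by
    refine integral_quadratic_sq_le G ν ζ hζ (fun u f hf => ?_) L b
    rw [hν, integral_map hYm.aemeasurable (measurable_of_finite _).aestronglyMeasurable]
    exact h.integral_mul_eq_zero u (ζ u) (hζ0 u) f hf
  have hab : ∀ u, |a u| ≤ (if u ∈ H then 1 else 0) + 2 * ε := by
    intro u
    simp only [a]
    split_ifs
    · rw [abs_sgn]; linarith
    · rw [abs_mul, abs_sgn, abs_of_pos (by linarith)]; linarith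
  have hb : ∀ v ∈ L, b v ^ 2 ≤ (2 * H.card + 8 * ε ^ 2 * B) * degR G v := by
    intro v hv
    have hvH : v ∉ H := (Finset.mem_sdiff.1 hv).2
    have hd := degR_nonneg G v
    set hh : ℝ := ∑ w ∈ H, adjInd G v w with hhdef
    have hh0 : 0 ≤ hh := Finset.sum_nonneg fun _ _ => adjInd_nonneg G _ _
    have hh1 : hh ≤ H.card := by
      refine (Finset.sum_le_card_nsmul _ _ 1 fun w _ => adjInd_le_one G v w).trans (by simp)
    have hh2 : hh ≤ degR G v :=
      Finset.sum_le_sum_of_subset_of_nonneg (Finset.subset_univ _)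
        fun _ _ _ => adjInd_nonneg G _ _
    have h1 : |b v| ≤ hh + 2 * ε * degR G v := by
      refine (Finset.abs_sum_le_sum_abs _ _).trans ?_
      have : ∀ w, |adjInd G v w * a w| ≤
          (if w ∈ H then adjInd G v w else 0) + 2 * ε * adjInd G v w := by
        intro w
        rw [abs_mul, abs_of_nonneg (adjInd_nonneg G v w)]
        refine (mul_le_mul_of_nonneg_left (hab w) (adjInd_nonneg G v w)).trans (le_of_eq ?_)
        split_ifs <;> ring
      refine (Finset.sum_le_sum fun w _ => this w).trans (le_of_eq ?_)
      rw [Finset.sum_add_distrib, ← Finset.mul_sum, Finset.sum_ite_mem, Finset.univ_inter, degR]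
    have h2 : b v ^ 2 ≤ (hh + 2 * ε * degR G v) ^ 2 := by
      rw [← sq_abs (b v)]
      gcongr
    have h3 : hh ^ 2 ≤ H.card * degR G v := by nlinarith
    have h4 : degR G v ^ 2 ≤ B * degR G v := by nlinarith [hB v hvH]
    have h5 : ε ^ 2 * degR G v ^ 2 ≤ ε ^ 2 * (B * degR G v) := by gcongr
    nlinarith [sq_nonneg (hh - 2 * ε * degR G v)]
  have hsum : ∑ v ∈ L, b v ^ 2 ≤ (2 * H.card + 8 * ε ^ 2 * B) * (2 * m) := by
    refine (Finset.sum_le_sum hb).trans ?_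
    rw [← Finset.mul_sum, hmdef, ← sum_degR]
    gcongr
    · exact fun v _ _ => degR_nonneg G v
    · exact Finset.subset_univ _
  have hW : ∀ y : Fin n → Bool, 4 * (cutValue G (fun v => if v ∈ H then x v else y v) : ℝ) =
      ∑ u, ∑ v, adjInd G u v * (1 - a u * a v) - D y := by
    intro y
    have hs : ∀ v, sgn (if v ∈ H then x v else y v) = a v + ζ v (y v) := by
      intro v
      simp only [a, ζ]
      split_ifs <;> ring
    have h1 : ∑ v ∈ L, b v * ζ v (y v) = ∑ u, ∑ v, adjInd G u v * (ζ u (y u) * a v) := by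
      rw [Finset.sum_subset (Finset.subset_univ L)]
      · refine Finset.sum_congr rfl fun u _ => ?_
        simp only [b]
        rw [Finset.sum_mul]
        exact Finset.sum_congr rfl fun v _ => by ring
      · intro v _ hv
        have : v ∈ H := by simpa [hL] using hv
        simp [ζ, this]
    have h2 : ∑ v ∈ L, b v * ζ v (y v) = ∑ u, ∑ v, adjInd G u v * (a u * ζ v (y v)) := by
      rw [h1, Finset.sum_comm]
      refine Finset.sum_congr rfl fun u _ => Finset.sum_congr rfl fun v _ => ?_
      rw [adjInd_comm]; ring
    rw [four_mul_cutValue]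
    simp only [D]
    rw [two_mul]
    nth_rewrite 1 [h1]
    rw [h2]
    simp only [← Finset.sum_add_distrib, ← Finset.sum_sub_distrib]
    refine Finset.sum_congr rfl fun u _ => Finset.sum_congr rfl fun v _ => ?_
    rw [hs, hs]; ring
  have hmean : (2 + 8 * ε ^ 2) * (maxCut G : ℝ) ≤
      ∑ u, ∑ v, adjInd G u v * (1 - a u * a v) := by
    have h1 := four_mul_cutValue G x
    rw [hx] at h1
    have h2 : (2 + 8 * ε ^ 2) * (maxCut G : ℝ) = (1 + 4 * ε ^ 2) / 2 * (4 * (maxCut G : ℝ)) := by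
      ring
    rw [h2, h1]
    simp only [Finset.mul_sum]
    refine Finset.sum_le_sum fun u _ => Finset.sum_le_sum fun v _ => ?_
    rw [mul_left_comm]
    refine mul_le_mul_of_nonneg_left ?_ (adjInd_nonneg G u v)
    simp only [a]
    split_ifs <;> cases x u <;> cases x v <;> simp [sgn] <;> nlinarith
  have hsub : {ω | (cutValue G (fun v => if v ∈ H then x v else Y v ω) : ℝ) <
        (1 / 2 + 2 * ε ^ 2) * maxCut G - ε ^ 2 * m / 4} ⊆
      (fun ω v => Y v ω) ⁻¹' {y | (ε ^ 2 * m) ^ 2 ≤ D y ^ 2} := by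
    intro ω hω
    simp only [Set.mem_ofPred_eq, Set.mem_preimage] at hω ⊢
    have h1 := hW fun v => Y v ω
    have h2 : ε ^ 2 * m ≤ D fun v => Y v ω := by linarith
    gcongr
  have hcheb := mul_meas_ge_le_integral_of_nonneg (μ := ν) (f := fun y => D y ^ 2)
    (ae_of_all _ fun y => sq_nonneg _) .of_finite ((ε ^ 2 * m) ^ 2)
  have hreal : μ.real {ω | (cutValue G (fun v => if v ∈ H then x v else Y v ω) : ℝ) <
        (1 / 2 + 2 * ε ^ 2) * maxCut G - ε ^ 2 * m / 4} ≤
      ν.real {y | (ε ^ 2 * m) ^ 2 ≤ D y ^ 2} := by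
    rw [hν, map_measureReal_apply hYm (Set.toFinite _).measurableSet]
    exact measureReal_mono hsub
  have hden : 0 < ε ^ 4 * m := by positivity
  refine hreal.trans ?_
  rw [le_div_iff₀ hden]
  refine le_of_mul_le_mul_right ?_ hm
  have e1 : ν.real {y | (ε ^ 2 * m) ^ 2 ≤ D y ^ 2} * (ε ^ 4 * m) * m =
      (ε ^ 2 * m) ^ 2 * ν.real {y | (ε ^ 2 * m) ^ 2 ≤ D y ^ 2} := by ring
  rw [e1]
  refine hcheb.trans (hint.trans ?_)
  nlinarith

end Tail

/-! ### Sampled degrees and gains -/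

/-- Markov's inequality for counting. -/
theorem card_filter_mul_le {R : Type*} [Fintype R] (f : R → ℝ) (hf : ∀ r, 0 ≤ f r) (t : ℝ)
    (P : R → Prop) [DecidablePred P] (hP : ∀ r, P r → t ≤ f r) :
    ((Finset.univ.filter P).card : ℝ) * t ≤ ∑ r, f r := by
  calc ((Finset.univ.filter P).card : ℝ) * t = ∑ r ∈ Finset.univ.filter P, t := by simp
    _ ≤ ∑ r ∈ Finset.univ.filter P, f r :=
        Finset.sum_le_sum fun r hr => hP r (Finset.mem_filter.1 hr).2
    _ ≤ ∑ r, f r := Finset.sum_le_sum_of_subset_of_nonneg (Finset.filter_subset _ _)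
        fun r _ _ => hf r

section Sampling

variable {n : ℕ} (G : SimpleGraph (Fin n)) {F : Type*} [Field F]

/-- The degree of `v` in the sample of edges hashed into `T`. -/
noncomputable def sampledDeg (key : Sym2 (Fin n) ↪ F) (T : Finset F) (r : F × F) (v : Fin n) : ℝ :=
  ∑ w, adjInd G v w * hashInd T r (key s(v, w))

/-- The signed degree of `v` in the sample of edges hashed into `T`. -/
noncomputable def sampledGain (key : Sym2 (Fin n) ↪ F) (T : Finset F) (r : F × F)
    (y : Fin n → Bool) (v : Fin n) : ℝ :=
  ∑ w, adjInd G v w * (sgn (y v) * sgn (y w)) * hashInd T r (key s(v, w))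

/-- The total squared error, over all vertices, of the rescaled sampled degrees and gains. -/
noncomputable def sqError (key : Sym2 (Fin n) ↪ F) (T : Finset F) (q : ℝ) (y : Fin n → Bool)
    (r : F × F) : ℝ :=
  ∑ v, ((q * sampledGain G key T r y v - gain G y v) ^ 2 +
    (q * sampledDeg G key T r v - degR G v) ^ 2)

open Classical in
/-- The edges hashed into `T`. -/
noncomputable def sampledEdges (key : Sym2 (Fin n) ↪ F) (T : Finset F) (r : F × F) :
    Finset (Sym2 (Fin n)) :=
  G.edgeFinset.filter fun e => r.1 * key e + r.2 ∈ T

variable [Fintype F]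

/-- Each edge contributes to four squared errors, each with expectation at most `q`. -/
theorem sum_sqError_le (key : Sym2 (Fin n) ↪ F) (T : Finset F) {q : ℝ} (hq : 0 < q)
    (hT : (T.card : ℝ) / Fintype.card F = q⁻¹) (y : Fin n → Bool) :
    ∑ r, sqError G key T q y r ≤ (Fintype.card (F × F) : ℝ) * (4 * q * G.edgeSet.ncard) := by
  have hinj : ∀ v : Fin n, Function.Injective fun w => key s(v, w) := fun v w w' h => 
    Sym2.congr_right.1 (key.injective h)
  have h1 : ∀ v, ∑ r : F × F, (q * sampledGain G key T r y v - gain G y v) ^ 2 ≤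
      (Fintype.card (F × F) : ℝ) * (q * degR G v) := by
    intro v
    have h := sum_hash_sq_le Finset.univ (fun w => key s(v, w)) (hinj v).injOn T
      (fun w => q * (adjInd G v w * (sgn (y v) * sgn (y w))))
    rw [hT] at h
    refine (le_of_eq (Finset.sum_congr rfl fun r _ => ?_)).trans (h.trans (le_of_eq ?_))
    · congr 1
      rw [sampledGain, gain, Finset.mul_sum, ← Finset.sum_sub_distrib]
      refine Finset.sum_congr rfl fun w _ => ?_
      field_simp
    · congr 1
      rw [degR, Finset.mul_sum, Finset.mul_sum]
      refine Finset.sum_congr rfl fun w _ => ?_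
      have e : (q * (adjInd G v w * (sgn (y v) * sgn (y w)))) ^ 2 =
          q ^ 2 * (adjInd G v w ^ 2 * ((sgn (y v) * sgn (y v)) * (sgn (y w) * sgn (y w)))) := by
        ring
      rw [e, sgn_mul_self, sgn_mul_self, adjInd_sq]
      field_simp
  have h2 : ∀ v, ∑ r : F × F, (q * sampledDeg G key T r v - degR G v) ^ 2 ≤
      (Fintype.card (F × F) : ℝ) * (q * degR G v) := by
    intro v
    have h := sum_hash_sq_le Finset.univ (fun w => key s(v, w)) (hinj v).injOn T
      (fun w => q * adjInd G v w)
    rw [hT] at h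
    refine (le_of_eq (Finset.sum_congr rfl fun r _ => ?_)).trans (h.trans (le_of_eq ?_))
    · congr 1
      rw [sampledDeg, degR, Finset.mul_sum, ← Finset.sum_sub_distrib]
      refine Finset.sum_congr rfl fun w _ => ?_
      field_simp
    · congr 1
      rw [degR, Finset.mul_sum, Finset.mul_sum]
      refine Finset.sum_congr rfl fun w _ => ?_
      rw [mul_pow, adjInd_sq]
      field_simp
  simp only [sqError]
  rw [Finset.sum_comm]
  simp only [Finset.sum_add_distrib]
  refine (add_le_add (Finset.sum_le_sum fun v _ => h1 v)
    (Finset.sum_le_sum fun v _ => h2 v)).trans (le_of_eq ?_)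
  rw [← Finset.mul_sum, ← Finset.mul_sum, sum_degR]
  ring

theorem sum_card_sampledEdges_le (key : Sym2 (Fin n) ↪ F) (T : Finset F) {q : ℝ}
    (hT : (T.card : ℝ) / Fintype.card F = q⁻¹) :
    ∑ r : F × F, ((sampledEdges G key T r).card - q⁻¹ * (G.edgeSet.ncard : ℝ)) ^ 2 ≤
      (Fintype.card (F × F) : ℝ) * (q⁻¹ * G.edgeSet.ncard) := by
  classical
  have h := sum_hash_sq_le G.edgeFinset key key.injective.injOn T (fun _ => 1)
  have h2 : G.edgeSet.ncard = G.edgeFinset.card := by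
    rw [← SimpleGraph.coe_edgeFinset, Set.ncard_coe_finset]
  rw [hT] at h
  rw [h2]
  simp only [one_pow, Finset.sum_const, nsmul_eq_mul, mul_one, one_mul, Finset.sum_sub_distrib] at h
  refine (le_of_eq (Finset.sum_congr rfl fun r _ => ?_)).trans h
  congr 1
  have : ∑ i ∈ G.edgeFinset, hashInd T r (key i) = ((sampledEdges G key T r).card : ℝ) := by
    simp only [hashInd, sampledEdges, Finset.sum_boole]
  rw [this]
  ring

end Sampling

section Estimate

variable {n : ℕ}

/-- The vertices whose estimated degree is at least `t`. -/
noncomputable def heavySet (t : ℝ) (dh : Fin n → ℝ) : Finset (Fin n) :=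
  Finset.univ.filter fun v => t ≤ dh v

/-- The estimate: the value `cut` of the predicted cut, increased by the positive estimated gains of
the heavy vertices and lowered by the slack `sl`. -/
noncomputable def cutEstimate (cut t sl : ℝ) (dh gh : Fin n → ℝ) : ℝ :=
  cut + ∑ v ∈ heavySet t dh, max 0 (gh v) - sl

variable (G : SimpleGraph (Fin n))

/-- If all degree estimates have error at most `t / 2`, there are few heavy vertices, and all the
others have small degree. -/
theorem degR_bounds_of_sqError {t : ℝ} (ht : 0 < t) {dh : Fin n → ℝ}
    (hd : ∀ v, (dh v - degR G v) ^ 2 ≤ (t / 2) ^ 2) :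
    (heavySet t dh).card * t ≤ 4 * (G.edgeSet.ncard : ℝ) ∧
      ∀ v ∉ heavySet t dh, degR G v ≤ 3 / 2 * t := by
  have habs : ∀ v, |dh v - degR G v| ≤ t / 2 := fun v => abs_le_of_sq_le_sq (hd v) (by linarith)
  constructor
  · have h1 : ((heavySet t dh).card : ℝ) * (t / 2) ≤ ∑ v, degR G v := by
      classical
      refine card_filter_mul_le _ (degR_nonneg G) _ _ fun v hv => ?_
      have := (abs_le.1 (habs v)).2
      linarith
    rw [sum_degR] at h1
    linarith
  · intro v hv
    have h1 : dh v < t := by simpa [heavySet] using hv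
    have := (abs_le.1 (habs v)).1
    linarith

/-- If the sampled statistics are accurate, the estimate lies between the value of the cut that
follows `x` on the heavy vertices and `y` elsewhere, up to the slack, and the maximum cut. -/
theorem cutEstimate_bounds (x y : Fin n → Bool) {t sl Z : ℝ} {dh gh : Fin n → ℝ}
    (hsl : 0 ≤ sl) (hZ : ∑ v, (gh v - gain G y v) ^ 2 ≤ Z)
    (hH : ((heavySet t dh).card : ℝ) ^ 2 ≤ sl / 4)
    (hZ2 : (heavySet t dh).card * Z ≤ (sl / 4) ^ 2) :
    cutEstimate (cutValue G y) t sl dh gh ≤ maxCut G ∧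
      (cutValue G (fun v => if v ∈ heavySet t dh then x v else y v) : ℝ) - 3 / 2 * sl ≤
        cutEstimate (cutValue G y) t sl dh gh := by
  set H := heavySet t dh with hHdef
  have h1 : |∑ v ∈ H, max 0 (gh v) - ∑ v ∈ H, max 0 (gain G y v)| ≤ sl / 4 := by
    have h2 : |∑ v ∈ H, max 0 (gh v) - ∑ v ∈ H, max 0 (gain G y v)| ≤
        ∑ v ∈ H, |gh v - gain G y v| := by
      rw [← Finset.sum_sub_distrib]
      refine (Finset.abs_sum_le_sum_abs _ _).trans (Finset.sum_le_sum fun v _ => ?_)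
      have := abs_max_sub_max_le_abs (gh v) (gain G y v) 0
      rwa [max_comm 0, max_comm 0]
    refine h2.trans (abs_le_of_sq_le_sq' ?_ (by linarith)).2
    refine le_trans ?_ hZ2
    refine (sq_sum_le_card_mul_sum_sq (s := H) (f := fun v => |gh v - gain G y v|)).trans ?_
    simp only [sq_abs]
    gcongr
    exact (Finset.sum_le_sum_of_subset_of_nonneg (Finset.subset_univ _)
      fun _ _ _ => sq_nonneg _).trans hZ
  have h1' := abs_le.1 h1
  have h3 := cutValue_add_gain_le_maxCut G y H
  have h4 := cutValue_piecewise_le G x y H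
  unfold cutEstimate
  rw [← hHdef]
  constructor <;> linarith

end Estimate

/-! ### The sketch and its decoding -/

section Sketch

variable {n : ℕ} {F : Type} [Field F]

/-- The state of the sketch: two counters modulo `M` for the edges and the edges cut by the
prediction, and, for each sampling level `j ≤ k`, the first `2 t` power sums of the codes of the
edges sampled at that level. -/
abbrev SketchVec (F : Type) (M k t : ℕ) : Type :=
  ZMod M × ZMod M × (Fin (k + 1) → Fin (2 * t) → F)

/-- An edge together with the predicted sides of its endpoints. -/
def annotatedEdge (y : Fin n → Bool) (e : Sym2 (Fin n)) : Sym2 (Fin n × Bool) :=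
  e.map fun v => (v, y v)

theorem annotatedEdge_injective (y : Fin n → Bool) : Function.Injective (annotatedEdge y) :=
  Sym2.map.injective fun _ _ h => (Prod.mk.inj h).1

open Classical in
/-- The contribution of one annotated edge to the sketch. The hash only depends on the edge, not on
its annotation, so that the sample is independent of the predictions. -/
noncomputable def edgeSketch (M k t : ℕ) (code : Sym2 (Fin n × Bool) ↪ F)
    (key : Sym2 (Fin n) ↪ F) (T : ℕ → Finset F) (r : F × F) (U : Sym2 (Fin n × Bool)) :
    SketchVec F M k t :=
  (1, if U.map Prod.snd = s(true, false) then 1 else 0,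
    fun j i => if r.1 * key (U.map Prod.fst) + r.2 ∈ T j then code U ^ (i : ℕ) else 0)

/-- The contribution of a stream item to the sketch. -/
noncomputable def itemSketch (M k t : ℕ) (code : Sym2 (Fin n × Bool) ↪ F)
    (key : Sym2 (Fin n) ↪ F) (T : ℕ → Finset F) (r : F × F) (a : AnnotatedUpdate n) :
    SketchVec F M k t :=
  a.update.sign • edgeSketch M k t code key T r s((a.update.u, a.predU), (a.update.v, a.predV))

open Classical in
/-- The number of edges that `x` cuts, counted through the annotations of the edges. -/
theorem card_filter_annotated_eq_cutValue (G : SimpleGraph (Fin n)) (y : Fin n → Bool) :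
    (G.edgeFinset.filter fun e => (annotatedEdge y e).map Prod.snd = s(true, false)).card =
      cutValue G y := by
  rw [cutValue, ← Set.ncard_coe_finset]
  congr 1
  ext e
  induction e with
  | h a b =>
    rw [Finset.mem_coe, Finset.mem_filter, SimpleGraph.mem_edgeFinset, SimpleGraph.mem_edgeSet]
    simp only [annotatedEdge, Sym2.map_mk, Set.mem_ofPred_eq]
    constructor
    · rintro ⟨h, h'⟩
      refine ⟨a, b, h, ?_, rfl⟩
      cases ha : y a <;> cases hb : y b <;> simp_all
    · rintro ⟨u, v, h, h', he⟩
      have h2 : G.Adj a b := by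
        have : s(a, b) ∈ G.edgeSet := by rw [he]; exact h
        exact this
      refine ⟨h2, ?_⟩
      rcases Sym2.eq_iff.1 he with ⟨rfl, rfl⟩ | ⟨rfl, rfl⟩ <;>
        cases ha : y a <;> cases hb : y b <;> simp_all

/-- The content of the sketch at the end of the stream. -/
theorem sum_itemSketch (M k t : ℕ) (code : Sym2 (Fin n × Bool) ↪ F)
    (key : Sym2 (Fin n) ↪ F) (T : ℕ → Finset F) (r : F × F) {G : SimpleGraph (Fin n)}
    {σ : List (EdgeUpdate n)} (hσ : IsDynamicStream σ G) (y : Fin n → Bool) :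
    ((annotate y σ).map (itemSketch M k t code key T r)).sum =
      ((G.edgeSet.ncard : ZMod M), (cutValue G y : ZMod M),
        fun (j : Fin (k + 1)) (i : Fin (2 * t)) =>
          ∑ e ∈ sampledEdges G key (T j) r, code (annotatedEdge y e) ^ (i : ℕ)) := by
  classical
  have h := hσ.sum_sign_smul fun e => edgeSketch M k t code key T r (annotatedEdge y e)
  have h1 : ((annotate y σ).map (itemSketch M k t code key T r)).sum =
      (σ.map fun a => a.sign • edgeSketch M k t code key T r
        (annotatedEdge y s(a.u, a.v))).sum := by
    rw [annotate, List.map_map]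
    rfl
  have h2 : ∀ e, (annotatedEdge y e).map Prod.fst = e := by
    intro e
    rw [annotatedEdge, Sym2.map_map]
    exact congrFun Sym2.map_id' e
  rw [h1, h]
  refine Prod.ext ?_ (Prod.ext ?_ ?_)
  · rw [Prod.fst_sum]
    simp only [edgeSketch, Finset.sum_const, nsmul_eq_mul, mul_one]
    rw [← SimpleGraph.coe_edgeFinset, Set.ncard_coe_finset]
  · rw [Prod.snd_sum, Prod.fst_sum]
    simp only [edgeSketch]
    rw [Finset.sum_boole, card_filter_annotated_eq_cutValue]
  · rw [Prod.snd_sum, Prod.snd_sum]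
    funext j i
    simp only [edgeSketch, h2, Finset.sum_apply, sampledEdges]
    rw [Finset.sum_filter]

open Classical in
/-- The set of at most `t` elements with the given power sums (the empty set if there is none). -/
noncomputable def decode {U : Type*} (code : U ↪ F) (t : ℕ) (syn : Fin (2 * t) → F) : Finset U :=
  if h : ∃ S : Finset U, S.card ≤ t ∧ ∀ i : Fin (2 * t), ∑ e ∈ S, code e ^ (i : ℕ) = syn i
  then h.choose else ∅

theorem decode_eq {U : Type*} (code : U ↪ F) {t : ℕ} {syn : Fin (2 * t) → F} {S : Finset U}
    (hS : S.card ≤ t) (h : ∀ i : Fin (2 * t), ∑ e ∈ S, code e ^ (i : ℕ) = syn i) :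
    decode code t syn = S := by
  classical
  have hex : ∃ S : Finset U, S.card ≤ t ∧ ∀ i : Fin (2 * t), ∑ e ∈ S, code e ^ (i : ℕ) = syn i :=
    ⟨S, hS, h⟩
  rw [decode, dif_pos hex]
  refine eq_of_powerSums_eq code hex.choose_spec.1 hS fun i hi => ?_
  rw [hex.choose_spec.2 ⟨i, hi⟩, h ⟨i, hi⟩]

open Classical in
/-- The sum of the weights `c a b` of the annotated edges `{(v, a), (w, b)}` of `S` at `v`. -/
noncomputable def edgeStat (S : Finset (Sym2 (Fin n × Bool))) (c : Bool → Bool → ℝ)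
    (v : Fin n) : ℝ :=
  ∑ w, ∑ a, ∑ b, if s((v, a), (w, b)) ∈ S then c a b else 0

open Classical in
theorem edgeStat_sampledEdges (G : SimpleGraph (Fin n)) (key : Sym2 (Fin n) ↪ F) (T : Finset F)
    (r : F × F) (y : Fin n → Bool) (c : Bool → Bool → ℝ) (v : Fin n) :
    edgeStat ((sampledEdges G key T r).image (annotatedEdge y)) c v =
      ∑ w, adjInd G v w * c (y v) (y w) * hashInd T r (key s(v, w)) := by
  have hmem : ∀ w a b, s((v, a), (w, b)) ∈ (sampledEdges G key T r).image (annotatedEdge y) ↔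
      (G.Adj v w ∧ r.1 * key s(v, w) + r.2 ∈ T) ∧ a = y v ∧ b = y w := by
    intro w a b
    rw [Finset.mem_image]
    constructor
    · rintro ⟨e, he, h⟩
      induction e with
      | h p q =>
        simp only [sampledEdges, Finset.mem_filter, SimpleGraph.mem_edgeFinset,
          SimpleGraph.mem_edgeSet] at he
        simp only [annotatedEdge, Sym2.map_mk] at h
        rcases Sym2.eq_iff.1 h with ⟨h1, h2⟩ | ⟨h1, h2⟩
        · obtain ⟨rfl, rfl⟩ := Prod.mk.inj h1
          obtain ⟨rfl, rfl⟩ := Prod.mk.inj h2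
          exact ⟨he, rfl, rfl⟩
        · obtain ⟨rfl, rfl⟩ := Prod.mk.inj h1
          obtain ⟨rfl, rfl⟩ := Prod.mk.inj h2
          rw [Sym2.eq_swap (a := q)]
          exact ⟨⟨he.1.symm, he.2⟩, rfl, rfl⟩
    · rintro ⟨h, rfl, rfl⟩
      refine ⟨s(v, w), ?_, rfl⟩
      simpa [sampledEdges] using h
  rw [edgeStat]
  refine Finset.sum_congr rfl fun w _ => ?_
  simp only [hmem]
  rw [Finset.sum_eq_single (y v) (fun a _ ha => by simp [ha]) (by simp),
    Finset.sum_eq_single (y w) (fun b _ hb => by simp [hb]) (by simp)]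
  by_cases h1 : G.Adj v w <;> by_cases h2 : r.1 * key s(v, w) + r.2 ∈ T <;>
    simp [h1, h2, adjInd, hashInd]

/-- The estimate computed from the final sketch: with `m` edges, the level `j` is chosen such that
`m / 2 ^ j` lies in `[N, 2 N)`, its sample is decoded, and the rescaled statistics of the sample
are used in `cutEstimate`. -/
noncomputable def sketchOutput {M k t : ℕ} (N : ℕ) (θ l : ℝ) (code : Sym2 (Fin n × Bool) ↪ F)
    (z : (F × F) × SketchVec F M k t) : ℝ :=
  let m := z.2.1.val
  let j := Nat.log 2 (m / N)
  let S := decode code t (z.2.2.2 (Fin.ofNat (k + 1) j))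
  cutEstimate z.2.2.1.val (θ * m) (l * m) (fun v => 2 ^ j * edgeStat S (fun _ _ => 1) v)
    fun v => 2 ^ j * edgeStat S (fun a b => sgn a * sgn b) v

theorem cutValue_le_ncard (G : SimpleGraph (Fin n)) (y : Fin n → Bool) :
    cutValue G y ≤ G.edgeSet.ncard := by
  classical
  rw [← card_filter_annotated_eq_cutValue, ← SimpleGraph.coe_edgeFinset, Set.ncard_coe_finset]
  exact Finset.card_filter_le _ _

theorem sketchOutput_eq {M k t N : ℕ} (θ l : ℝ) (code : Sym2 (Fin n × Bool) ↪ F)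
    (key : Sym2 (Fin n) ↪ F) (T : ℕ → Finset F) (r : F × F) {G : SimpleGraph (Fin n)}
    {σ : List (EdgeUpdate n)} (hσ : IsDynamicStream σ G) (y : Fin n → Bool)
    (hM : G.edgeSet.ncard < M) {j : ℕ} (hj : j = Nat.log 2 (G.edgeSet.ncard / N)) (hjk : j ≤ k)
    (hcard : (sampledEdges G key (T j) r).card ≤ t) :
    sketchOutput N θ l code (r, ((annotate y σ).map (itemSketch M k t code key T r)).sum) =
      cutEstimate (cutValue G y) (θ * G.edgeSet.ncard) (l * G.edgeSet.ncard)
        (fun v => 2 ^ j * sampledDeg G key (T j) r v)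
        fun v => 2 ^ j * sampledGain G key (T j) r y v := by
  classical
  rw [sum_itemSketch M k t code key T r hσ y]
  have h1 : ((G.edgeSet.ncard : ZMod M)).val = G.edgeSet.ncard := ZMod.val_cast_of_lt hM
  have h2 : ((cutValue G y : ZMod M)).val = cutValue G y :=
    ZMod.val_cast_of_lt ((cutValue_le_ncard G y).trans_lt hM)
  have h3 : ((Fin.ofNat (k + 1) j : Fin (k + 1)) : ℕ) = j :=
    Nat.mod_eq_of_lt (Nat.lt_succ_of_le hjk)
  have h4 : decode code t (fun i : Fin (2 * t) =>
      ∑ e ∈ sampledEdges G key (T (Fin.ofNat (k + 1) j : Fin (k + 1))) r,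
        code (annotatedEdge y e) ^ (i : ℕ)) =
      (sampledEdges G key (T j) r).image (annotatedEdge y) := by
    rw [h3]
    refine decode_eq code ((Finset.card_image_le).trans hcard) fun i => ?_
    rw [Finset.sum_image fun _ _ _ _ h => annotatedEdge_injective y h]
  simp only [sketchOutput, h1, h2, ← hj, h4, edgeStat_sampledEdges, mul_one]
  rfl

end Sketch

/-! ### Field, memory and success probability -/

/-- For each sampling level `j ≤ k`, a field with `2 ^ k ≥ 4 n ^ 2` elements has a set of density
`2 ^ (-j)`, and it has room for distinct codes of all annotated edges. -/
theorem exists_field_of_codes (n k : ℕ) (hk : k ≠ 0) (hn : 4 * n ^ 2 ≤ 2 ^ k) :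
    ∃ (F : Type) (_ : Field F) (_ : Fintype F), Fintype.card F = 2 ^ k ∧
      Nonempty (Sym2 (Fin n × Bool) ↪ F) ∧ Nonempty (Sym2 (Fin n) ↪ F) ∧
      ∃ T : ℕ → Finset F, ∀ j ≤ k, (T j).card = 2 ^ (k - j) := by
  classical
  let F := GaloisField 2 k
  let _ : Fintype F := Fintype.ofFinite F
  have hF : Fintype.card F = 2 ^ k := by
    rw [← Nat.card_eq_fintype_card]
    exact GaloisField.card 2 k hk
  have hcode : Nonempty (Sym2 (Fin n × Bool) ↪ F) := by
    refine Function.Embedding.nonempty_of_card_le ?_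
    rw [hF, Sym2.card, Fintype.card_prod, Fintype.card_fin, Fintype.card_bool,
      Nat.choose_two_right, Nat.add_sub_cancel]
    refine le_trans ?_ hn
    refine Nat.div_le_of_le_mul ?_
    rcases Nat.eq_zero_or_pos n with rfl | h
    · simp
    · nlinarith
  refine ⟨F, inferInstance, inferInstance, hF, hcode,
    hcode.map fun c => ⟨fun e => c (annotatedEdge (fun _ => true) e),
      c.injective.comp (annotatedEdge_injective _)⟩, ?_⟩
  have hT : ∀ j, ∃ T : Finset F, j ≤ k → T.card = 2 ^ (k - j) := by
    intro j
    have : 2 ^ (k - j) ≤ (Finset.univ : Finset F).card := by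
      rw [Finset.card_univ, hF]
      exact Nat.pow_le_pow_right (by norm_num) (Nat.sub_le _ _)
    obtain ⟨T, -, hT⟩ := Finset.exists_subset_card_eq this
    exact ⟨T, fun _ => hT⟩
  choose T hT using hT
  exact ⟨T, hT⟩

/-- The number of bits that hold a seed and the sketch. -/
theorem nonempty_stateEmbedding {F : Type} [Fintype F] {k : ℕ} (hF : Fintype.card F = 2 ^ k)
    (t : ℕ) :
    Nonempty ((F × F) × SketchVec F (2 ^ k) k t ↪ (Fin (k * (4 + 2 * t * (k + 1))) → Bool)) := by
  refine Function.Embedding.nonempty_of_card_le (le_of_eq ?_)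
  simp only [Fintype.card_prod, ZMod.card, Fintype.card_fun, Fintype.card_fin, Fintype.card_bool,
    hF]
  rw [← pow_mul, ← pow_mul, ← pow_add, ← pow_add, ← pow_add, ← pow_add]
  congr 1
  ring

theorem ncard_edgeSet_lt {n k : ℕ} (G : SimpleGraph (Fin n)) (hn : 4 * n ^ 2 ≤ 2 ^ k) :
    G.edgeSet.ncard < 2 ^ k := by
  have h1 : ∑ v, degR G v ≤ (n : ℝ) * n := by
    have : ∀ v, degR G v ≤ n := fun v => by
      refine (Finset.sum_le_card_nsmul _ _ 1 fun w _ => adjInd_le_one G v w).trans (by simp)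
    refine (Finset.sum_le_card_nsmul _ _ _ fun v _ => this v).trans (by simp)
  rw [sum_degR] at h1
  have h2 : 2 * G.edgeSet.ncard ≤ n * n := by exact_mod_cast h1
  have h3 : 0 < 2 ^ k := by positivity
  nlinarith

section Success

variable {n : ℕ} {F : Type} [Field F] [Fintype F]

open Classical in
/-- For every prediction vector, few seeds yield inaccurate statistics or too large a sample. -/
theorem card_bad_seeds_le (G : SimpleGraph (Fin n)) (key : Sym2 (Fin n) ↪ F) (T : Finset F)
    {q δ : ℝ} {N : ℕ} (hq : 0 < q) (hT : (T.card : ℝ) / Fintype.card F = q⁻¹) (hN : 0 < N)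
    (hδ : 0 < δ) (hqN : q * N ≤ G.edgeSet.ncard) (hqN2 : (G.edgeSet.ncard : ℝ) ≤ 2 * (q * N))
    (h1 : 2 / δ ≤ N) (y : Fin n → Bool) :
    ((Finset.univ.filter fun r : F × F =>
      16 * (G.edgeSet.ncard : ℝ) ^ 2 / (N * δ) < sqError G key T q y r ∨
        4 * N < (sampledEdges G key T r).card).card : ℝ) ≤
      δ / 2 * (Fintype.card (F × F) : ℝ) := by
  set m : ℝ := (G.edgeSet.ncard : ℝ) with hm
  set c : ℝ := (Fintype.card (F × F) : ℝ) with hc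
  have hN' : (0 : ℝ) < N := by exact_mod_cast hN
  have hm0 : 0 < m := lt_of_lt_of_le (by positivity) hqN
  have hc0 : 0 ≤ c := by positivity
  set Z : ℝ := 16 * m ^ 2 / (N * δ) with hZ
  have hZ0 : 0 < Z := by positivity
  have hA : ((Finset.univ.filter fun r : F × F => Z < sqError G key T q y r).card : ℝ) ≤
      δ / 4 * c := by
    have h := (card_filter_mul_le (sqError G key T q y)
      (fun r => Finset.sum_nonneg fun v _ => by positivity) Z
      (fun r => Z < sqError G key T q y r) fun r hr => hr.le).trans (sum_sqError_le G key T hq hT y)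
    refine le_of_mul_le_mul_right (h.trans ?_) hZ0
    have e : δ / 4 * c * Z = c * (4 * (m / N) * m) := by
      rw [hZ]; field_simp; ring
    rw [e]
    have : q ≤ m / N := by rwa [le_div_iff₀ hN']
    gcongr
  have hB : ((Finset.univ.filter fun r : F × F => 4 * N < (sampledEdges G key T r).card).card : ℝ) ≤
      δ / 4 * c := by
    have hq2 : q⁻¹ * m ≤ 2 * N := by
      rw [inv_mul_le_iff₀ hq]; linarith
    have h := (card_filter_mul_le
      (fun r : F × F => ((sampledEdges G key T r).card - q⁻¹ * m) ^ 2)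
      (fun r => sq_nonneg _) ((2 * N) ^ 2)
      (fun r => 4 * N < (sampledEdges G key T r).card) fun r hr => by
        have hr' : (4 : ℝ) * N < ((sampledEdges G key T r).card : ℝ) := by exact_mod_cast hr
        have : 2 * (N : ℝ) ≤ (sampledEdges G key T r).card - q⁻¹ * m := by linarith
        gcongr).trans (sum_card_sampledEdges_le G key T hT)
    refine le_of_mul_le_mul_right (h.trans ?_) (show (0 : ℝ) < (2 * N) ^ 2 by positivity)
    have h2 : 2 ≤ N * δ := by rwa [div_le_iff₀ hδ] at h1
    have e : δ / 4 * c * (2 * N) ^ 2 = c * (N * (N * δ)) := by ring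
    rw [e]
    refine mul_le_mul_of_nonneg_left ?_ hc0
    nlinarith
  have hU : (Finset.univ.filter fun r : F × F => Z < sqError G key T q y r ∨
      4 * N < (sampledEdges G key T r).card) =
      (Finset.univ.filter fun r : F × F => Z < sqError G key T q y r) ∪
      Finset.univ.filter fun r : F × F => 4 * N < (sampledEdges G key T r).card :=
    Finset.filter_or _ _ _
  rw [hU]
  refine (Nat.cast_le.2 (Finset.card_union_le _ _)).trans ?_
  push_cast
  linarith

/-- The success probability of the sketch, under explicit conditions on its parameters: `N` is the
order of the sample size, `θ` is the fraction of the edges that makes a vertex heavy and `l` is the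
fraction of the edges used as slack. -/
theorem sketch_success {Ω : Type*} [MeasurableSpace Ω] {μ : Measure Ω}
    [IsProbabilityMeasure μ] {Y : Fin n → Ω → Bool} {x : Fin n → Bool} {ε : ℝ}
    (h : IsAccuratePrediction μ Y x ε) (hε : 0 < ε) (hε2 : ε ≤ 1 / 2) {G : SimpleGraph (Fin n)}
    (hx : cutValue G x = maxCut G) {σ : List (EdgeUpdate n)} (hσ : IsDynamicStream σ G)
    {k N s : ℕ} (code : Sym2 (Fin n × Bool) ↪ F) (key : Sym2 (Fin n) ↪ F) (T : ℕ → Finset F)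
    (hF : Fintype.card F = 2 ^ k) (hT : ∀ j ≤ k, (T j).card = 2 ^ (k - j))
    (enc : (F × F) × SketchVec F (2 ^ k) k (4 * N) ↪ (Fin s → Bool))
    (hmk : G.edgeSet.ncard < 2 ^ k) {θ l δ : ℝ} (hN : 0 < N) (hθ : 0 < θ) (hl : 0 < l)
    (hδ : 0 < δ) (hmN : (N : ℝ) ≤ G.edgeSet.ncard) (h1 : 2 / δ ≤ N)
    (h2 : 64 / (δ * θ ^ 2) ≤ N) (h3 : 1024 / (θ * δ * l ^ 2) ≤ N)
    (h4 : (4 / θ) ^ 2 ≤ l * G.edgeSet.ncard / 4)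
    (h5 : (128 * (4 / θ) + 512 * ε ^ 2 * (3 / 2 * (θ * G.edgeSet.ncard)) + 128) /
      (ε ^ 4 * G.edgeSet.ncard) ≤ δ / 2) (h6 : l ≤ ε ^ 2 / 6) :
    ENNReal.ofReal (1 - δ) ≤
      estimateProb μ (sketchAlgorithm enc (itemSketch (2 ^ k) k (4 * N) code key T)
        (sketchOutput N θ l code)) Y σ
        (Set.Icc ((1 / 2 + 1 * ε ^ 2) * (maxCut G : ℝ)) (maxCut G : ℝ)) := by
  classical
  set I : Set ℝ := Set.Icc ((1 / 2 + 1 * ε ^ 2) * (maxCut G : ℝ)) (maxCut G : ℝ) with hI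
  have hYm := measurable_prediction h.measurable
  have hN' : (0 : ℝ) < N := by exact_mod_cast hN
  set mn : ℕ := G.edgeSet.ncard with hmn
  set m : ℝ := (mn : ℝ) with hm
  have hm0 : 0 < m := hN'.trans_le hmN
  have hmNn : N ≤ mn := by rw [hm] at hmN; exact_mod_cast hmN
  set j : ℕ := Nat.log 2 (mn / N) with hj
  have hdiv : mn / N ≠ 0 := (Nat.div_pos hmNn hN).ne'
  have hjl : 2 ^ j * N ≤ mn :=
    (Nat.le_div_iff_mul_le hN).1 (Nat.pow_log_le_self 2 hdiv)
  have hju : mn < 2 ^ (j + 1) * N :=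
    (Nat.div_lt_iff_lt_mul hN).1 (Nat.lt_pow_succ_log_self (by norm_num) _)
  have hjk : j ≤ k := by
    have : 2 ^ j < 2 ^ k := lt_of_le_of_lt (le_trans (Nat.le_mul_of_pos_right _ hN) hjl) hmk
    exact ((Nat.pow_lt_pow_iff_right (by norm_num)).1 this).le
  set q : ℝ := 2 ^ j with hq
  have hq0 : 0 < q := by positivity
  have hqN : q * N ≤ m := by rw [hq, hm]; exact_mod_cast hjl
  have hqN2 : m ≤ 2 * (q * N) := by
    have : (mn : ℝ) < 2 ^ (j + 1) * N := by exact_mod_cast hju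
    rw [pow_succ] at this
    rw [hq, hm]; linarith
  have hTq : ((T j).card : ℝ) / Fintype.card F = q⁻¹ := by
    rw [hT j hjk, hF, hq]
    push_cast
    rw [pow_sub₀ _ (by norm_num) hjk]
    field_simp
  set Z : ℝ := 16 * m ^ 2 / (N * δ) with hZ
  have hZ1 : Z ≤ (θ * m / 2) ^ 2 := by
    rw [div_le_iff₀ (by positivity)] at h2
    rw [hZ, div_le_iff₀ (by positivity)]
    nlinarith [mul_le_mul_of_nonneg_left h2 (sq_nonneg m)]
  have hZ2 : 4 / θ * Z ≤ (l * m / 4) ^ 2 := by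
    rw [div_le_iff₀ (by positivity)] at h3
    have e : 4 / θ * Z = 64 * m ^ 2 / (θ * (N * δ)) := by rw [hZ]; field_simp; norm_num
    rw [e, div_le_iff₀ (by positivity)]
    nlinarith [mul_le_mul_of_nonneg_left h3 (sq_nonneg m)]
  have hZ0 : 0 ≤ Z := by positivity
  -- The heavy set depends on the seed only, hence not on the predictions.
  let dh : F × F → Fin n → ℝ := fun r v => q * sampledDeg G key (T j) r v
  let H : F × F → Finset (Fin n) := fun r => heavySet (θ * m) (dh r)
  let bad1 : F × F → (Fin n → Bool) → Prop := fun r y =>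
    Z < sqError G key (T j) q y r ∨ 4 * N < (sampledEdges G key (T j) r).card
  let cutLow : F × F → Set Ω := fun r =>
    {ω | (cutValue G (fun v => if v ∈ H r then x v else Y v ω) : ℝ) <
        (1 / 2 + 2 * ε ^ 2) * maxCut G - ε ^ 2 * m / 4}
  let degGood : F × F → Prop := fun r =>
    ((H r).card * (θ * m) ≤ 4 * m ∧ ∀ v ∉ H r, degR G v ≤ 3 / 2 * (θ * m))
  let o : F × F → (Fin n → Bool) → ℝ := fun r y => sketchOutput N θ l code
    (r, ((annotate y σ).map (itemSketch (2 ^ k) k (4 * N) code key T r)).sum)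
  have hcardH : ∀ r, degGood r → ((H r).card : ℝ) ≤ 4 / θ := by
    intro r hr
    rw [le_div_iff₀ hθ]
    refine le_of_mul_le_mul_right ?_ hm0
    linarith [hr.1]
  have hsub : ∀ r, {ω | o r (fun v => Y v ω) ∉ I} ⊆
      {ω | bad1 r fun v => Y v ω} ∪ {ω | degGood r ∧ ω ∈ cutLow r} := by
    intro r ω hω
    by_contra hcon
    apply hω
    set y : Fin n → Bool := fun v => Y v ω with hy
    simp only [Set.mem_union, Set.mem_ofPred_eq, not_or, bad1, not_lt, not_and] at hcon
    obtain ⟨⟨hc1, hc2⟩, hc3⟩ := hcon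
    have hsum := hc1
    rw [sqError, Finset.sum_add_distrib] at hsum
    have hs1 : ∑ v, (q * sampledGain G key (T j) r y v - gain G y v) ^ 2 ≤ Z :=
      (le_add_of_nonneg_right (Finset.sum_nonneg fun _ _ => sq_nonneg _)).trans hsum
    have hs2 : ∑ v, (q * sampledDeg G key (T j) r v - degR G v) ^ 2 ≤ Z :=
      (le_add_of_nonneg_left (Finset.sum_nonneg fun _ _ => sq_nonneg _)).trans hsum
    have hdeg : degGood r := degR_bounds_of_sqError G (by positivity) fun v =>
      ((Finset.single_le_sum (f := fun v => (q * sampledDeg G key (T j) r v - degR G v) ^ 2)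
        (fun _ _ => sq_nonneg _) (Finset.mem_univ v)).trans hs2).trans hZ1
    have hHc := hcardH r hdeg
    have hb := cutEstimate_bounds G x y (t := θ * m) (sl := l * m) (Z := Z) (dh := dh r)
      (gh := fun v => q * sampledGain G key (T j) r y v) (by positivity) hs1
      (le_trans (by gcongr) h4) (le_trans (by gcongr) hZ2)
    have hout : o r y = cutEstimate (cutValue G y) (θ * m) (l * m) (dh r)
        fun v => q * sampledGain G key (T j) r y v :=
      sketchOutput_eq θ l code key T r hσ y hmk hj hjk hc2
    have hcut : (1 / 2 + 2 * ε ^ 2) * maxCut G - ε ^ 2 * m / 4 ≤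
        (cutValue G (fun v => if v ∈ H r then x v else y v) : ℝ) := not_lt.1 (hc3 hdeg)
    rw [hout]
    refine ⟨?_, hb.1⟩
    have hm2 : m ≤ 2 * maxCut G := ncard_le_two_mul_maxCut G
    have hlm : l * m ≤ ε ^ 2 / 6 * m := by gcongr
    have hem : ε ^ 2 * m ≤ ε ^ 2 * (2 * maxCut G) := by gcongr
    have := hb.2
    linarith
  have hpre : ∀ P : (Fin n → Bool) → Prop, MeasurableSet {ω | P fun v => Y v ω} := fun P =>
    hYm (Set.toFinite {y | P y}).measurableSet
  have hbad2 : ∀ r, μ.real {ω | degGood r ∧ ω ∈ cutLow r} ≤ δ / 2 := by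
    intro r
    by_cases hr : degGood r
    · have e : {ω | degGood r ∧ ω ∈ cutLow r} = cutLow r := by
        ext ω; simp [hr]
      rw [e]
      refine (h.cut_tail G hε hε2 hx hm0 (H r) (by positivity) hr.2).trans (le_trans ?_ h5)
      have := hcardH r hr
      gcongr
    · simp only [hr, false_and]
      have : {ω : Ω | False} = ∅ := by ext; simp
      rw [this]
      simp
      positivity
  have hbad1 : ∑ r, μ.real {ω | bad1 r fun v => Y v ω} ≤ δ / 2 * Fintype.card (F × F) := by
    have e : ∀ r, μ.real {ω | bad1 r fun v => Y v ω} =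
        ∫ ω, {ω | bad1 r fun v => Y v ω}.indicator (fun _ => (1 : ℝ)) ω ∂μ := fun r => by
      rw [integral_indicator_const _ (hpre (bad1 r))]; simp
    simp_rw [e]
    have hi : ∀ r, Integrable ({ω | bad1 r fun v => Y v ω}.indicator fun _ => (1 : ℝ)) μ :=
      fun r => (integrable_const _).indicator (hpre (bad1 r))
    rw [← integral_finsetSum _ fun r _ => hi r]
    have hle : ∀ ω, ∑ r, {ω | bad1 r fun v => Y v ω}.indicator (fun _ => (1 : ℝ)) ω ≤
        δ / 2 * Fintype.card (F × F) := by
      intro ω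
      refine le_trans (le_of_eq ?_)
        (card_bad_seeds_le G key (T j) hq0 hTq hN hδ hqN hqN2 h1 fun v => Y v ω)
      simp only [Set.indicator_apply, Set.mem_ofPred_eq]
      rw [Finset.sum_boole]
    have := integral_mono (integrable_finsetSum _ fun r _ => hi r)
      (integrable_const (δ / 2 * (Fintype.card (F × F) : ℝ))) hle
    simpa using this
  have hlaw : estimateProb μ (sketchAlgorithm enc (itemSketch (2 ^ k) k (4 * N) code key T)
        (sketchOutput N θ l code)) Y σ I =
      ∫⁻ ω, ((PMF.uniformOfFintype (F × F)).map fun r => o r fun v => Y v ω).toOuterMeasure I ∂μ := by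
    rw [estimateProb]
    simp_rw [sketchAlgorithm_outputLaw]
    rfl
  rw [hlaw]
  refine le_lintegral_uniform_map μ (fun r ω => o r fun v => Y v ω) I δ
    (fun r => hpre fun y => o r y ∉ I) ?_
  calc ∑ r, μ.real {ω | o r (fun v => Y v ω) ∉ I}
      ≤ ∑ r, (μ.real {ω | bad1 r fun v => Y v ω} + δ / 2) :=
        Finset.sum_le_sum fun r _ => (measureReal_mono (hsub r)).trans
          ((measureReal_union_le _ _).trans (add_le_add le_rfl (hbad2 r)))
    _ ≤ δ * Fintype.card (F × F) := by
        rw [Finset.sum_add_distrib, Finset.sum_const, Finset.card_univ, nsmul_eq_mul]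
        linarith

end Success

/-! ### Choice of the parameters -/

/-- The memory used by the sketch, as a function of `n` and of the sample size `N`. -/
theorem sketch_bits_le {n N : ℕ} (hn : 2 ≤ n) (hN : 0 < N) {k : ℕ} (hk : k = 2 * Nat.log 2 n + 4) :
    ((k * (4 + 2 * (4 * N) * (k + 1)) : ℕ) : ℝ) ≤ 1188 * N * Real.log n ^ 2 := by
  have hl2 : (0.69 : ℝ) < Real.log 2 := lt_trans (by norm_num) Real.log_two_gt_d9
  have hL : Real.log 2 ≤ Real.log n := Real.log_le_log (by norm_num) (by exact_mod_cast hn)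
  have hlog : (Nat.log 2 n : ℝ) * Real.log 2 ≤ Real.log n := by
    rw [← Real.log_pow]
    refine Real.log_le_log (by positivity) ?_
    exact_mod_cast Nat.pow_log_le_self 2 (by omega)
  have h0 : (0 : ℝ) ≤ Nat.log 2 n := Nat.cast_nonneg _
  have h1 : (Nat.log 2 n : ℝ) ≤ 1.5 * Real.log n := by nlinarith
  have hN1 : (1 : ℝ) ≤ N := by exact_mod_cast hN
  have hk1 : (k : ℝ) ≤ 9 * Real.log n := by
    rw [hk]; push_cast; linarith
  have hk2 : (k : ℝ) + 1 ≤ 11 * Real.log n := by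
    rw [hk]; push_cast; linarith
  have hk0 : (0 : ℝ) ≤ k := Nat.cast_nonneg _
  have h3 : (k : ℝ) * (k + 1) ≤ 9 * Real.log n * (11 * Real.log n) := by gcongr
  push_cast
  have h4 : (1 : ℝ) ≤ N * (k + 1) := by nlinarith
  calc (k : ℝ) * (4 + 2 * (4 * N) * (k + 1)) ≤ k * (12 * (N * (k + 1))) := by
        gcongr; linarith
    _ = 12 * N * (k * (k + 1)) := by ring
    _ ≤ 12 * N * (9 * Real.log n * (11 * Real.log n)) := by gcongr
    _ = _ := by ring

theorem mainTheorem2 (κ : ℝ) (hκ : 1 ≤ κ) :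
    ∃ c : ℝ, 0 < c ∧ ∃ C : ℝ, 0 < C ∧ ∃ K : ℝ, 0 < K ∧
      ∀ (n : ℕ) (ε' δ : ℝ), 0 < ε' → ε' ≤ 1 / 2 → 0 < δ → δ < 1 →
        ∃ (s : ℕ) (A : StreamingAlgorithm (AnnotatedUpdate n) s),
          (s : ℝ) ≤ C * (Real.log n ^ 2 / (ε' ^ 7 * δ ^ 3) * Real.log (1 / (ε' * δ))) ∧
          ∀ ε : ℝ, 0 < ε → ε ≤ 1 / 2 → ε ≤ κ * ε' → ε' ≤ κ * ε →
          ∀ (G : SimpleGraph (Fin n)) (σ : List (EdgeUpdate n)), IsDynamicStream σ G →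
            K / (ε ^ 11 * δ ^ 7) ≤ (G.edgeSet.ncard : ℝ) →
          ∀ x : Fin n → Bool, cutValue G x = maxCut G →
          ∀ (Ω : Type*) [MeasurableSpace Ω] (μ : Measure Ω) [IsProbabilityMeasure μ]
            (Y : Fin n → Ω → Bool), IsAccuratePrediction μ Y x ε →
            ENNReal.ofReal (1 - δ) ≤
              estimateProb μ A Y σ
                (Set.Icc ((1 / 2 + c * ε ^ 2) * (maxCut G : ℝ)) (maxCut G : ℝ)) := by
  have hκ0 : 0 < κ := by linarith
  -- `A / (ε' ^ 6 * δ ^ 3)` is the order of the number of sampled edges.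
  set A : ℝ := 64 * 3072 ^ 2 * κ ^ 6 with hA
  have hA1 : 1 ≤ κ ^ 6 := one_le_pow₀ hκ
  have hA2 : 64 * 3072 ^ 2 ≤ A := by rw [hA]; linarith
  have hA0 : 0 < A := by linarith
  refine ⟨1, one_pos, 4752 * A, by positivity, 6 * A * κ ^ 6, by positivity, ?_⟩
  intro n ε' δ hε' hε'2 hδ hδ1
  have he1 : ε' ≤ 1 := by linarith
  rcases Nat.lt_or_ge n 2 with hn | hn
  · -- With at most one vertex there are no edges, and the hypothesis on `m` fails.
    refine ⟨0, ⟨PMF.pure default, fun _ _ => PMF.pure default, fun _ => 0⟩, ?_, ?_⟩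
    · have : Real.log n = 0 := by interval_cases n <;> simp
      simp [this]
    · intro ε hε _ _ _ G σ _ hm
      exfalso
      have hG : G.edgeSet.ncard = 0 := by
        have : Subsingleton (Fin n) := Fin.subsingleton_iff_le_one.2 (by omega)
        have hbot : G = ⊥ := by
          ext u v
          simp only [SimpleGraph.bot_adj, iff_false]
          exact fun h => h.ne (Subsingleton.elim u v)
        simp [hbot]
      rw [hG] at hm
      have : 0 < 6 * A * κ ^ 6 / (ε ^ 11 * δ ^ 7) := by positivity
      simp only [Nat.cast_zero] at hm
      linarith
  set X : ℝ := A / (ε' ^ 6 * δ ^ 3) with hX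
  have hX0 : 0 < X := by positivity
  have hd1 : ∀ i : ℕ, δ ^ i ≤ 1 := fun i => pow_le_one₀ hδ.le hδ1.le
  have hp1 : ∀ i : ℕ, ε' ^ i ≤ 1 := fun i => pow_le_one₀ hε'.le he1
  set N : ℕ := ⌈X⌉₊ with hN
  have hXN : X ≤ N := Nat.le_ceil X
  have hN0 : 0 < N := Nat.ceil_pos.2 hX0
  have hX1 : 1 ≤ X := by
    rw [hX, le_div_iff₀ (by positivity), one_mul]
    have := mul_le_one₀ (hp1 6) (by positivity) (hd1 3)
    linarith
  have hN2 : (N : ℝ) ≤ 2 * X := by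
    have := (Nat.ceil_lt_add_one hX0.le).le
    linarith
  set k : ℕ := 2 * Nat.log 2 n + 4 with hk
  have hnk : 4 * n ^ 2 ≤ 2 ^ k := by
    have h1 : n < 2 ^ (Nat.log 2 n + 1) := Nat.lt_pow_succ_log_self (by norm_num) n
    calc 4 * n ^ 2 ≤ 4 * (2 ^ (Nat.log 2 n + 1)) ^ 2 := by gcongr
      _ = 2 ^ k := by rw [hk]; ring
  obtain ⟨F, _, _, hF, ⟨code⟩, ⟨key⟩, T, hT⟩ := exists_field_of_codes n k (by omega) hnk
  obtain ⟨enc⟩ := nonempty_stateEmbedding hF (4 * N)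
  set θ : ℝ := ε' ^ 2 * δ / (3072 * κ ^ 2) with hθ
  set l : ℝ := ε' ^ 2 / (6 * κ ^ 2) with hl
  have hθ0 : 0 < θ := by positivity
  have hl0 : 0 < l := by positivity
  refine ⟨_, sketchAlgorithm enc (itemSketch (2 ^ k) k (4 * N) code key T)
    (sketchOutput N θ l code), ?_, ?_⟩
  · refine (sketch_bits_le hn hN0 hk).trans ?_
    have hlog : 1 / 2 ≤ Real.log (1 / (ε' * δ)) := by
      have h1 : Real.log 2 ≤ Real.log (1 / (ε' * δ)) := by
        refine Real.log_le_log (by norm_num) ?_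
        rw [le_div_iff₀ (by positivity)]
        nlinarith
      have := Real.log_two_gt_d9
      linarith
    have hX7 : X ≤ A / (ε' ^ 7 * δ ^ 3) := by
      rw [hX]
      have : ε' ^ 7 ≤ ε' ^ 6 := pow_le_pow_of_le_one hε'.le he1 (by norm_num)
      gcongr
    have hL0 : 0 ≤ Real.log n ^ 2 := sq_nonneg _
    calc 1188 * N * Real.log n ^ 2 ≤ 1188 * (2 * (A / (ε' ^ 7 * δ ^ 3))) * Real.log n ^ 2 := by
          gcongr; linarith
      _ = 4752 * A * (Real.log n ^ 2 / (ε' ^ 7 * δ ^ 3) * (1 / 2)) := by ring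
      _ ≤ _ := by gcongr
  · intro ε hε hε2 hεκ hεκ' G σ hσ hm x hx Ω _ μ _ Y hY
    set m : ℝ := (G.edgeSet.ncard : ℝ) with hmdef
    have hε1 : ε ≤ 1 := by linarith
    have hsq : ε ^ 2 ≤ κ ^ 2 * ε' ^ 2 := by rw [← mul_pow]; gcongr
    have hsq' : ε' ^ 2 ≤ κ ^ 2 * ε ^ 2 := by rw [← mul_pow]; gcongr
    have hmK : 6 * A * κ ^ 6 / (ε ^ 6 * δ ^ 3) ≤ m := by
      refine le_trans ?_ hm
      have h1 : ε ^ 11 ≤ ε ^ 6 := pow_le_pow_of_le_one hε.le hε1 (by norm_num)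
      have h2 : δ ^ 7 ≤ δ ^ 3 := pow_le_pow_of_le_one hδ.le hδ1.le (by norm_num)
      gcongr
    have hmX : 6 * X ≤ m := by
      refine le_trans ?_ hmK
      rw [hX, ← mul_div_assoc, div_le_div_iff₀ (by positivity) (by positivity)]
      have h1 : ε ^ 6 ≤ κ ^ 6 * ε' ^ 6 := by rw [← mul_pow]; gcongr
      have h2 := mul_le_mul_of_nonneg_left h1 (show 0 ≤ 6 * A * δ ^ 3 by positivity)
      linarith
    have hm0 : 0 < m := by linarith
    have hd31 : δ ^ 3 ≤ δ := by
      simpa using pow_le_pow_of_le_one hδ.le hδ1.le (show 1 ≤ 3 by norm_num)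
    have hd32 : δ ^ 3 ≤ δ ^ 2 := pow_le_pow_of_le_one hδ.le hδ1.le (by norm_num)
    have he64 : ε' ^ 6 ≤ ε' ^ 4 := pow_le_pow_of_le_one hε'.le he1 (by norm_num)
    refine sketch_success hY hε hε2 hx hσ code key T hF hT enc (ncard_edgeSet_lt G hnk) hN0 hθ0
      hl0 hδ (by linarith) ?_ ?_ ?_ ?_ ?_ ?_
    · refine le_trans ?_ hXN
      rw [hX]
      have h1 : ε' ^ 6 * δ ^ 3 ≤ 1 * δ := by gcongr; exact hp1 6
      rw [one_mul] at h1
      have h2 : (2 : ℝ) ≤ A := by linarith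
      gcongr
    · refine le_trans ?_ hXN
      have e : 64 / (δ * θ ^ 2) = 64 * 3072 ^ 2 * κ ^ 4 / (ε' ^ 4 * δ ^ 3) := by
        rw [hθ]; field_simp
      rw [e, hX, hA]
      have h1 : κ ^ 4 ≤ κ ^ 6 := pow_le_pow_right₀ hκ (by norm_num)
      gcongr
    · refine le_trans ?_ hXN
      have e : 1024 / (θ * δ * l ^ 2) = 1024 * 3072 * 36 * κ ^ 6 / (ε' ^ 6 * δ ^ 2) := by
        rw [hθ, hl]; field_simp; norm_num
      rw [e, hX, hA]
      gcongr ?_ * _ / (_ * ?_)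
      norm_num
    · have e : (4 / θ) ^ 2 = l / 4 * (6 * (A / (ε' ^ 6 * δ ^ 2))) := by
        rw [hθ, hl, hA]; field_simp; norm_num
      rw [e]
      have h1 : A / (ε' ^ 6 * δ ^ 2) ≤ X := by rw [hX]; gcongr
      have h2 : l / 4 * (6 * (A / (ε' ^ 6 * δ ^ 2))) ≤ l / 4 * m := by gcongr; linarith
      linarith
    · have hθ1 : θ ≤ 1 := by
        rw [hθ, div_le_one (by positivity)]
        have : 1 ≤ κ ^ 2 := one_le_pow₀ hκ
        have := mul_le_one₀ (hp1 2) hδ.le hδ1.le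
        linarith
      have hθε : θ * 3072 ≤ δ * ε ^ 2 := by
        have e : θ * 3072 = δ * (ε' ^ 2 / κ ^ 2) := by rw [hθ]; field_simp
        rw [e]
        gcongr
        rw [div_le_iff₀ (by positivity)]; linarith
      have hmθ : 2560 / θ ≤ δ * ε ^ 4 * m := by
        have h1 : 1 / ε' ^ 2 ≤ κ ^ 2 / ε ^ 2 := by
          rw [div_le_div_iff₀ (by positivity) (by positivity)]; linarith
        have e1 : 2560 / θ = 2560 * 3072 * κ ^ 2 / δ * (1 / ε' ^ 2) := by rw [hθ]; field_simp
        have e2 : δ * ε ^ 4 * (6 * A * κ ^ 6 / (ε ^ 6 * δ ^ 3)) =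
            6 * A * κ ^ 6 / (ε ^ 2 * δ ^ 2) := by field_simp
        have h2 : δ * ε ^ 4 * (6 * A * κ ^ 6 / (ε ^ 6 * δ ^ 3)) ≤ δ * ε ^ 4 * m := by gcongr
        have e3 : 2560 * 3072 * κ ^ 2 / δ * (κ ^ 2 / ε ^ 2) =
          2560 * 3072 * κ ^ 4 / (ε ^ 2 * δ) := by field_simp
        have h4 : κ ^ 4 ≤ κ ^ 6 := pow_le_pow_right₀ hκ (by norm_num)
        have h5 : δ ^ 2 ≤ δ := by
          simpa using pow_le_pow_of_le_one hδ.le hδ1.le (show 1 ≤ 2 by norm_num)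
        have h7 : 2560 * 3072 * κ ^ 4 ≤ 6 * A * κ ^ 6 :=
          mul_le_mul (by linarith) h4 (by positivity) (by positivity)
        calc 2560 / θ ≤ 2560 * 3072 * κ ^ 2 / δ * (κ ^ 2 / ε ^ 2) := by rw [e1]; gcongr
          _ = 2560 * 3072 * κ ^ 4 / (ε ^ 2 * δ) := e3
          _ ≤ 6 * A * κ ^ 6 / (ε ^ 2 * δ ^ 2) := by gcongr
          _ ≤ _ := by rw [← e2]; exact h2
      have h128 : 128 ≤ 128 / θ := by rw [le_div_iff₀ hθ0]; linarith
      have e4 : 128 * (4 / θ) + 128 / θ = 2560 / θ / 4 := by ring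
      rw [div_le_iff₀ (by positivity)]
      have h6 : 512 * ε ^ 2 * (3 / 2 * (θ * m)) ≤ δ / 4 * (ε ^ 4 * m) := by
        have := mul_le_mul_of_nonneg_left hθε (show 0 ≤ ε ^ 2 * m / 4 by positivity)
        linarith
      linarith
    · rw [hl, div_le_div_iff₀ (by positivity) (by positivity)]
      linarith
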